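/- Let $V=\{v_0,v_1,v_2,\dots\}$, let $\mathbb{Q}\langle V\rangle$ be the free associative algebra on $V$ with unit $\mathbf 1$, and let $\mathrm{Lie}(V)\subset\mathbb{Q}\langle V\rangle$ be the free Lie algebra, i.e. the Lie subalgebra (for the commutator) generated by $V$. Let $\mathrm{co}$ be the algebra morphism $\mathbb{Q}\langle V\rangle\to\mathbb{Q}\langle V\rangle\otimes\mathbb{Q}\langle V\rangle$ with $\mathrm{co}(v_s)=v_s\otimes\mathbf 1+\mathbf 1\otimes v_s$, written $\mathrm{co}(A)=A_{(1)}\otimes A_{(2)}$; let $S$ be the linear algebra anti-morphism of $\mathbb{Q}\langle V\rangle$ with $S(v_s)=-v_s$; let $\sqcup\!\!\sqcup $ be the shuffle product on $\mathbb{Q}\langle V\rangle$; and let $(\cdot\mid\cdot)$ be the bilinear pairing on $\mathbb{Q}\langle V\rangle$ for which the words are orthonormal, extended by $(A\otimes B\mid C_1\otimes C_2)=(A\mid C_1)(B\mid C_2)$. For $k,l\in\mathbb{Z}_{\ge0}$ read $\binom{k-1}{l-1}$ as $1$ if $k=l=0$ and as $0$ if exactly one of $k,l$ is $0$. The ari multiplicity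 of $\mathbf k,\mathbf l\in\mathbb{Z}_{\ge0}^d$ is $\operatorname{m}_{\mathbf k,\mathbf l}=(-1)^{|\mathbf k|+|\mathbf l|}\prod_{p=1}^d\binom{k_p-1}{l_p-1}$, where $|\mathbf k|=k_1+\dots+k_d$ (so $\operatorname{m}_{\emptyset,\emptyset}=1$). Let $M(V)$ be the free magma on $V$, with product $\star$. For $t\in M(V)$ with letters $v_{k_1},\dots,v_{k_d}$ from left to right write $t=t(\mathbf k)$, and let $t(\mathbf l)$ be obtained from $t$ by replacing $k_p$ by $l_p$ for all $p$. Define $t\triangleright_a u\in M(V)_{\mathbb{Q}}$ for $t=t(\mathbf k),u\in M(V)$ by $t\triangleright_a v_0=0$, $t\triangleright_a v_s=\sum_{\mathbf l}\operatorname{m}_{\mathbf k,\mathbf l}\,v_{s+|\mathbf k-\mathbf l|}\star t(\mathbf l)$ for $s\ge1$, and $t\triangleright_a(u\star w)=(t\triangleright_a u)\star w+u\star(t\triangleright_a w)$. Let $\mathrm{Lie}:M(V)_{\mathbb{Q}}\to\mathrm{Lie}(V)$ be the linear map with $v_s\mapsto v_s$ and $x\star y\mapsto[\mathrm{Lie}(x),\mathrm{Lie}(y)]$.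 **Theorem.** There is a unique bilinear map $\triangleright_a$ on $\mathbb{Q}\langle V\rangle$ such that $\mathrm{Lie}(t)\triangleright_a\mathrm{Lie}(u)=\mathrm{Lie}(t\triangleright_a u)$ for all $t,u\in M(V)$ and, for all $x,y\in\mathrm{Lie}(V)$ and $A,B,C\in\mathbb{Q}\langle V\rangle$, $$x\triangleright_a\mathbf 1=0,\quad \mathbf 1\triangleright_a A=A,\quad (xA)\triangleright_a y=x\triangleright_a(A\triangleright_a y)-(x\triangleright_a A)\triangleright_a y,\quad A\triangleright_a(BC)=(A_{(1)}\triangleright_a B)(A_{(2)}\triangleright_a C).$$ Put $A\circledast_a B=A_{(1)}(A_{(2)}\triangleright_a B)$. There is a unique linear map $\Delta_a:\mathbb{Q}\langle V\rangle\to\mathbb{Q}\langle V\rangle\otimes\mathbb{Q}\langle V\rangle$ with $(A\circledast_a B\mid C)=(A\otimes B\mid\Delta_a(C))$ for all $A,B,C\in\mathbb{Q}\langle V\rangle$. For every $d\ge0$ and $\mathbf k=(k_1,\dots,k_d)\in\mathbb{Z}_{\ge0}^d$ one has $$\begin{aligned}\Delta_a(v_{k_1}\cdots v_{k_d})=\sum_{\substack{0\le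 n\le d\\ 0\le i_1<j_1\le i_2<j_2\le\cdots\le i_n<j_n\le d}}\ \sum_{\mathbf l=(\mathbf l_1,\dots,\mathbf l_n)}&\operatorname{m}_{\widehat{\mathbf k}^{j_1,\dots,j_n}+\mathbf l,\ \widehat{\mathbf k}^{j_1,\dots,j_n}}\\ \Big(v_{k_1}\cdots v_{k_{i_1}}\ \sqcup\!\!\sqcup \ S(v_{k_{i_1+1}+l_{i_1+1}}\cdots v_{k_{j_1-1}+l_{j_1-1}})\ \sqcup\!\!\sqcup \ &v_{k_{j_1+1}+l_{j_1+1}}\cdots v_{k_{i_2}+l_{i_2}}\ \sqcup\!\!\sqcup \ \cdots\\ \sqcup\!\!\sqcup \ S(v_{k_{i_n+1}+l_{i_n+1}}\cdots v_{k_{j_n-1}+l_{j_n-1}})\ \sqcup\!\!\sqcup \ &v_{k_{j_n+1}+l_{j_n+1}}\cdots v_{k_d+l_d}\Big)\otimes v_{k_{j_1}-|\mathbf l_1|}\cdots v_{k_{j_n}-|\mathbf l_n|}.\end{aligned}$$ Here $i_{n+1}=d$ (so the term $n=0$ is $v_{k_1}\cdots v_{k_d}\otimes\mathbf 1$). The inner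 sum runs over the tuples $\mathbf l_s=(l_p)_{i_s<p\le i_{s+1},\,p\ne j_s}$ of non-negative integers, $s=1,\dots,n$, such that for each $s$ either $\mathbf l_s=\emptyset$ or $|\mathbf l_s|\le k_{j_s}-1$. The index $\widehat{\mathbf k}^{j_1,\dots,j_n}$ is $\mathbf k$ with the components $k_{j_1},\dots,k_{j_n}$ omitted, and in $\widehat{\mathbf k}^{j_1,\dots,j_n}+\mathbf l$ one puts $l_p=0$ for $p\le i_1$. -/

import Mathlib

open scoped TensorProduct

noncomputable section

namespace Ari

/-- The free noncommutative algebra `ℚ⟨V⟩` on the letters `V = {v₀, v₁, v₂, …}`;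
the letter `v_s` is represented by its index `s`. -/
abbrev QV : Type := FreeAlgebra ℚ ℕ

/-- The letter `v_s`. -/
def v (s : ℕ) : QV := FreeAlgebra.ι ℚ s

/-- The word `v_{a₁} ⋯ v_{aₙ}` attached to the list `[a₁, …, aₙ]`; the empty list gives `1`. -/
def word (w : List ℕ) : QV := (w.map v).prod

/-- The basis of `ℚ⟨V⟩` consisting of all words. -/
def wordBasis : Module.Basis (FreeMonoid ℕ) ℚ QV := FreeAlgebra.basisFreeMonoid ℚ ℕ

/-- The basis vectors are the words. -/
theorem wordBasis_ofList (w : List ℕ) : wordBasis (FreeMonoid.ofList w) = word w := by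
  simp [wordBasis, FreeAlgebra.basisFreeMonoid, FreeAlgebra.equivMonoidAlgebraFreeMonoid, word,
    FreeMonoid.lift_apply]
  rfl

/-- The commutator bracket `[A, B] = A B - B A` on `ℚ⟨V⟩`. -/
instance instLieRingQV : LieRing QV := LieRing.ofAssociativeRing

/-- The free Lie algebra `Lie(V)`, as the Lie subalgebra of `ℚ⟨V⟩` generated by the letters. -/
abbrev LieV : LieSubalgebra ℚ QV := LieSubalgebra.lieSpan ℚ QV (Set.range v)

/-- The shuffle coproduct on `ℚ⟨V⟩`: the algebra morphism with `v_s ↦ v_s ⊗ 1 + 1 ⊗ v_s`. -/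
def co : QV →ₐ[ℚ] QV ⊗[ℚ] QV :=
  FreeAlgebra.lift ℚ fun s => v s ⊗ₜ[ℚ] (1 : QV) + (1 : QV) ⊗ₜ[ℚ] v s

/-- The antipode: the algebra anti-morphism of `ℚ⟨V⟩` with `v_s ↦ -v_s`. -/
def antipode : QV →ₗ[ℚ] QV :=
  (MulOpposite.opLinearEquiv ℚ).symm.toLinearMap ∘ₗ
    (FreeAlgebra.lift ℚ fun s => MulOpposite.op (-v s) : QV →ₐ[ℚ] QVᵐᵒᵖ).toLinearMap

/-- The shuffle product of two words. -/
def shuffleWords : List ℕ → List ℕ → QV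
  | [], w => word w
  | x :: u, [] => word (x :: u)
  | x :: u, y :: w => v x * shuffleWords u (y :: w) + v y * shuffleWords (x :: u) w
termination_by u w => u.length + w.length

/-- The shuffle product on `ℚ⟨V⟩`. -/
def shuffle : QV →ₗ[ℚ] QV →ₗ[ℚ] QV :=
  wordBasis.constr ℚ fun u => wordBasis.constr ℚ fun w => shuffleWords u.toList w.toList

/-- The pairing on `ℚ⟨V⟩` for which the words are orthonormal. -/
def pairing : LinearMap.BilinForm ℚ QV := wordBasis.constr ℚ fun u => wordBasis.coord u

/-! ### The ari multiplicities -/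

/-- `binom(k-1, l-1)`, with value `1` for `k = l = 0` and `0` if exactly one of `k, l` is `0`. -/
def shiftedChoose : ℕ → ℕ → ℕ
  | 0, 0 => 1
  | 0, _ + 1 => 0
  | _ + 1, 0 => 0
  | k + 1, l + 1 => k.choose l

/-- The ari multiplicity `m_{k,l}` of two tuples of non-negative integers. -/
def mult {ι : Type*} [Fintype ι] (k l : ι → ℕ) : ℚ :=
  (-1) ^ ((∑ p, k p) + ∑ p, l p) * ∏ p, (shiftedChoose (k p) (l p) : ℚ)

/-- The multiplicity `m_{k,l}` vanishes unless `l ≤ k`. -/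
theorem mult_eq_zero {ι : Type*} [Fintype ι] (k l : ι → ℕ) (h : ¬ l ≤ k) : mult k l = 0 := by
  rw [Pi.le_def, not_forall] at h
  obtain ⟨p, hp⟩ := h
  have h0 : shiftedChoose (k p) (l p) = 0 := by
    generalize k p = a at hp
    generalize l p = b at hp
    match a, b with
    | 0, 0 => simp at hp
    | 0, _ + 1 => rfl
    | _ + 1, 0 => rfl
    | a + 1, b + 1 => exact Nat.choose_eq_zero_of_lt (by omega)
  rw [mult, Finset.prod_eq_zero (Finset.mem_univ p) (by rw [h0, Nat.cast_zero]), mul_zero]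

/-! ### The ari triangle on the free magma -/

/-- The indices of the letters of `t ∈ M(V)`, from left to right. -/
def labels : (t : FreeMagma ℕ) → Fin t.length → ℕ
  | .of s => fun _ => s
  | .mul t u => Fin.append (labels t) (labels u)

/-- `t(l)`: the indices of the letters of `t ∈ M(V)`, from left to right, are replaced by `l`. -/
def relabel : (t : FreeMagma ℕ) → (Fin t.length → ℕ) → FreeMagma ℕ
  | .of _ => fun l => .of (l ⟨0, Nat.one_pos⟩)
  | .mul t u => fun l =>
      relabel t (fun p => l (Fin.castAdd u.length p)) * relabel u (fun p => l (Fin.natAdd t.length p))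

/-- The vector space `M(V)_ℚ` spanned by the free magma `M(V)`, with its product `⋆`. -/
abbrev MQ : Type := FreeNonUnitalNonAssocAlgebra ℚ ℕ

/-- An element of `M(V)`, viewed in `M(V)_ℚ`. -/
def tree (t : FreeMagma ℕ) : MQ := MonoidAlgebra.ofMagma ℚ (FreeMagma ℕ) t

/-- The ari triangle `t ▷ u` for `t, u ∈ M(V)`: on letters, `t(k) ▷ v₀ = 0` and
`t(k) ▷ v_s = ∑_l m_{k,l} v_{s + |k - l|} ⋆ t(l)` for `s ≥ 1`, where only `l ≤ k` contribute;
it is extended as a derivation in the right factor. -/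
def triangleMagma (t : FreeMagma ℕ) : FreeMagma ℕ → MQ
  | .of s =>
      if s = 0 then 0
      else ∑ l ∈ Finset.Iic (labels t),
        mult (labels t) l • (tree (.of (s + ∑ p, (labels t p - l p))) * tree (relabel t l))
  | .mul u w => triangleMagma t u * tree w + tree u * triangleMagma t w

/-- The morphism `M(V)_ℚ → Lie(V)` with `v_s ↦ v_s` and `x ⋆ y ↦ [x, y]`
(`CommutatorRing L` is `L` with its bracket as product). -/
def toLie : MQ →ₙₐ[ℚ] CommutatorRing LieV :=
  FreeNonUnitalNonAssocAlgebra.lift ℚ fun s =>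
    (⟨v s, LieSubalgebra.subset_lieSpan (Set.mem_range_self s)⟩ : LieV)

/-- The element of `Lie(V)`, viewed in `ℚ⟨V⟩`, which is the image of `x ∈ M(V)_ℚ`. -/
def lie (x : MQ) : QV := LieV.incl (toLie x)

/-! ### The extension to `ℚ⟨V⟩`, the Grossman–Larson product and its dual coproduct -/

/-- `∑ (A₍₁₎ ▷ B) (A₍₂₎ ▷ C)`, where `∑ A₍₁₎ ⊗ A₍₂₎ = co A`. -/
def sweedlerMul (T : QV →ₗ[ℚ] QV →ₗ[ℚ] QV) (A B C : QV) : QV :=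
  LinearMap.mul' ℚ QV (TensorProduct.map (T.flip B) (T.flip C) (co A))

/-- `T`, written `A ▷ B = T A B`, is the extension to `ℚ⟨V⟩ = U(Lie(V))` of the ari post-Lie
product on `Lie(V)`, the latter being induced by the ari triangle on the free magma. -/
structure IsAriTriangle (T : QV →ₗ[ℚ] QV →ₗ[ℚ] QV) : Prop where
  on_lie : ∀ t u : FreeMagma ℕ, T (lie (tree t)) (lie (tree u)) = lie (triangleMagma t u)
  lie_one : ∀ x ∈ LieV, T x 1 = 0
  one_left : ∀ A, T 1 A = A
  mul_left : ∀ x ∈ LieV, ∀ A, ∀ y ∈ LieV, T (x * A) y = T x (T A y) - T (T x A) y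
  mul_right : ∀ A B C, T A (B * C) = sweedlerMul T A B C

/-- The Grossman–Larson product `A ⊛ B = ∑ A₍₁₎ (A₍₂₎ ▷ B)`, where `∑ A₍₁₎ ⊗ A₍₂₎ = co A`. -/
def glProduct (T : QV →ₗ[ℚ] QV →ₗ[ℚ] QV) (A B : QV) : QV :=
  LinearMap.mul' ℚ QV (TensorProduct.map LinearMap.id (T.flip B) (co A))

/-- `Δ` is dual to the Grossman–Larson product: `(A ⊛ B ∣ C) = (A ⊗ B ∣ Δ C)`, where
`(A ⊗ B ∣ C₁ ⊗ C₂) = (A ∣ C₁) (B ∣ C₂)`. -/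
def IsDualCoproduct (T : QV →ₗ[ℚ] QV →ₗ[ℚ] QV) (Δ : QV →ₗ[ℚ] QV ⊗[ℚ] QV) : Prop :=
  ∀ A B C : QV, pairing (glProduct T A B) C = (pairing.tmul pairing) (A ⊗ₜ[ℚ] B) (Δ C)

/-! ### The explicit formula

Positions in a word of length `d` are numbered `0, …, d - 1`. The cuts are
`i 0 < i 1 < ⋯ < i n = d`, the `s`-th block consists of the positions `p` with
`i s ≤ p < i (s + 1)`, and `j s` is a position in the `s`-th block. -/

section formula

variable {d n : ℕ}

/-- The pairs `(i, j)` with `i_s < j_s ≤ i_{s+1}` for all `s`, where `i_{n+1} = d`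
(written for the position `j_s - 1` in place of `j_s`). -/
def cuts (d n : ℕ) : Finset ((Fin (n + 1) → Fin (d + 1)) × (Fin n → Fin d)) :=
  Finset.univ.filter fun ij =>
    (ij.1 (Fin.last n) : ℕ) = d ∧
      ∀ s : Fin n, (ij.1 s.castSucc : ℕ) ≤ ij.2 s ∧ (ij.2 s : ℕ) < ij.1 s.succ

/-- The positions of the `s`-th block other than `j s`; they index the tuple `l_s`. -/
def block (i : Fin (n + 1) → Fin (d + 1)) (j : Fin n → Fin d) (s : Fin n) : Finset (Fin d) :=
  Finset.univ.filter fun p =>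
    (i s.castSucc : ℕ) ≤ p ∧ (p : ℕ) < i s.succ ∧ p ≠ j s

/-- The tuples `l = (l_1, …, l_n)`, encoded as functions on all positions which vanish outside
the blocks, such that for every `s` the tuple `l_s` is empty or `|l_s| ≤ k_{j_s} - 1`
(that is, `|l_s| < k_{j_s}`).
The bound `∑ k` on the entries follows from these conditions and only makes the set finite. -/
def shifts (k : Fin d → ℕ) (i : Fin (n + 1) → Fin (d + 1)) (j : Fin n → Fin d) :
    Finset (Fin d → ℕ) :=
  (Finset.Iic fun _ => ∑ p, k p).filter fun l =>
    (∀ p, (∀ s, p ∉ block i j s) → l p = 0) ∧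
      ∀ s, block i j s = ∅ ∨ ∑ p ∈ block i j s, l p < k (j s)

/-- The word `∏ v_{f p}` over the positions `a ≤ p < b`, in increasing order. -/
def subword (f : Fin d → ℕ) (a b : ℕ) : QV :=
  word (((List.finRange d).filter fun p : Fin d => a ≤ p.val ∧ p.val < b).map f)

/-- The left tensor factor: the shuffle product of the prefix in front of the first cut and, for
`s = 1, …, n`, of the antipode of the part of the `s`-th block before `j s` and of the part of the
`s`-th block after `j s`, with indices shifted by `l`. -/
def leftFactor (k : Fin d → ℕ) (i : Fin (n + 1) → Fin (d + 1)) (j : Fin n → Fin d)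
    (l : Fin d → ℕ) : QV :=
  (List.finRange n).foldl
    (fun acc s =>
      shuffle (shuffle acc (antipode (subword (k + l) (i s.castSucc) (j s))))
        (subword (k + l) (j s + 1) (i s.succ)))
    (subword k 0 (i 0))

/-- The right tensor factor `v_{k_{j_1} - |l_1|} ⋯ v_{k_{j_n} - |l_n|}`. -/
def rightFactor (k : Fin d → ℕ) (i : Fin (n + 1) → Fin (d + 1)) (j : Fin n → Fin d)
    (l : Fin d → ℕ) : QV :=
  word (List.ofFn fun s => k (j s) - ∑ p ∈ block i j s, l p)

/-- The multiplicity `m_{k̂ + l, k̂}`, where `k̂` is `k` without the entries at `j_1, …, j_n`. -/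
def formulaMult (k : Fin d → ℕ) (j : Fin n → Fin d) (l : Fin d → ℕ) : ℚ :=
  mult (fun p : {p : Fin d // ∀ s, p ≠ j s} => k p + l p) (fun p => k p)

/-- The right-hand side of the formula for the coproduct of `v_{k_1} ⋯ v_{k_d}`. -/
def coproductFormula (k : Fin d → ℕ) : QV ⊗[ℚ] QV :=
  ∑ n ∈ Finset.range (d + 1), ∑ ij ∈ cuts d n, ∑ l ∈ shifts k ij.1 ij.2,
    formulaMult k ij.2 l • (leftFactor k ij.1 ij.2 l ⊗ₜ[ℚ] rightFactor k ij.1 ij.2 l)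

end formula

end Ari

end

/-!
The triangle is constructed without the Poincaré–Birkhoff–Witt theorem. Let `Φ` be the algebra
morphism `ℚ⟨V⟩ → ℚ⟨V⟩[X]` with `v_k ↦ ∑_l m_{k,l} v_l X^{k-l}` (`shiftHom`), and write `Φ_j` for its
coefficients. By the product formula for the multiplicities, the triangle on the magma descends to
`x ▷ v_s = ∑_j [v_{s+j}, Φ_j x]` for `x ∈ Lie(V)` and `s ≥ 1` (`shiftHom_lie_tree`,
`ariTriangle_on_lie`). This makes sense on all of `ℚ⟨V⟩` after iterating brackets: the letter `v_k`
acts on sequences `G` by `(v_k G)(s) = ∑_j [G (s+j), Φ_j v_k]` for `s ≥ 1` and by zero for `s = 0`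
(`letterOp`), so words act from the right on the sequence `v` of letters, and the value at `s` is
`A ▷ v_s`. The rule for `A ▷ (B C)` says that `B ↦ (A ↦ A ▷ B)` is an algebra morphism to the
convolution algebra of endomorphisms, hence it is determined by its values on letters
(`triangleHom`).

The post-Lie identity is `(x A + x ▷ A) ▷ B = x ▷ (A ▷ B)` for `x ∈ Lie(V)`
(`ariTriangle_glLeft`). The map `A ↦ x A + x ▷ A` is a coderivation and `x ▷ ·` is a derivation, so
it suffices to take for `B` a letter. There it says that `x ▷ ·` commutes with every `Φ_j`. As `Φ`
is the exponential of `X D` for the derivation `D` with `v_k ↦ -(k-1) v_{k-1}` (`lowering`), this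
reduces to the commutation of two derivations, which is checked on letters (`ariTriangle_lowering`).

Uniqueness of the triangle is an induction on the length of products of Lie elements
(`IsAriTriangle.eq_on_lieProducts`), together with the fact that `A ↦ A ▷ 1` is a convolution
idempotent (`IsAriTriangle.word_right_one`).

For the coproduct, functionals `(· ∣ C)` on `ℚ⟨V⟩` form an algebra under convolution, in which the
product is the shuffle product (`dual_shuffle`). The functional dual to `A ↦ A ▷ v_s`, evaluated on
a word, is a sum over the position of the letter that `v_s` becomes and over the shifts of the other
letters (`pairing_act_subword`): letters of `A` are removed one by one from the right, and each of
them is matched with the first or with the last letter of the word. Since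
`A ⊛ (B v_s) = ∑ (A₍₁₎ ⊛ B) (A₍₂₎ ▷ v_s)` and deconcatenation is dual to concatenation, the explicit
formula follows by splitting off the last block (`dualComp_glConv_word`). Existence and uniqueness
of the dual coproduct are then consequences of the formula and of the nondegeneracy of the pairing.
-/

noncomputable section

namespace Ari

/-! ### The bialgebra `ℚ⟨V⟩` -/

/-- The counit of `ℚ⟨V⟩`: the algebra morphism killing all letters. -/
def counitHom : QV →ₐ[ℚ] ℚ := FreeAlgebra.lift ℚ fun _ => 0

@[simp] theorem counitHom_v (s : ℕ) : counitHom (v s) = 0 := by simp [counitHom, v]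

@[simp] theorem co_v (s : ℕ) : co (v s) = v s ⊗ₜ[ℚ] (1 : QV) + (1 : QV) ⊗ₜ[ℚ] v s := by
  simp [co, v]

theorem algHom_ext_v {R : Type*} [Semiring R] [Algebra ℚ R] {f g : QV →ₐ[ℚ] R}
    (h : ∀ s, f (v s) = g (v s)) : f = g :=
  FreeAlgebra.hom_ext (funext h)

/-- The bialgebra structure on `ℚ⟨V⟩` with comultiplication `co`. -/
instance instBialgebraQV : Bialgebra ℚ QV :=
  Bialgebra.ofAlgHom co counitHom
    (algHom_ext_v fun s => by
      simp [TensorProduct.tmul_add, TensorProduct.add_tmul, Algebra.TensorProduct.one_def,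
        add_assoc])
    (algHom_ext_v fun s => by simp)
    (algHom_ext_v fun s => by simp)

theorem comul_eq_co (A : QV) : Coalgebra.comul (R := ℚ) A = co A := rfl

theorem word_nil : word [] = 1 := rfl

theorem word_cons (a : ℕ) (w : List ℕ) : word (a :: w) = v a * word w := by simp [word]

theorem word_append (u w : List ℕ) : word (u ++ w) = word u * word w := by simp [word]

theorem word_singleton (a : ℕ) : word [a] = v a := by simp [word]

theorem linearMap_ext_word {M : Type*} [AddCommMonoid M] [Module ℚ M] {f g : QV →ₗ[ℚ] M}
    (h : ∀ w, f (word w) = g (word w)) : f = g :=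
  wordBasis.ext fun w => by
    have := h w.toList
    rwa [← wordBasis_ofList] at this

theorem span_word : Submodule.span ℚ (Set.range word) = ⊤ := by
  rw [eq_top_iff, ← wordBasis.span_eq, Submodule.span_le]
  rintro _ ⟨w, rfl⟩
  exact Submodule.subset_span ⟨w.toList, (wordBasis_ofList _).symm⟩

/-- Induction on `ℚ⟨V⟩`, words being built up by appending letters on the right. -/
theorem induction_right {p : QV → Prop} (one : p 1) (add : ∀ A B, p A → p B → p (A + B))
    (smul : ∀ (r : ℚ) A, p A → p (r • A)) (mul : ∀ A k, p A → p (A * v k)) (A : QV) : p A := by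
  have h : A ∈ Submodule.span ℚ (Set.range word) := span_word ▸ Submodule.mem_top
  induction h using Submodule.span_induction with
  | mem _ h =>
    obtain ⟨w, rfl⟩ := h
    induction w using List.reverseRecOn with
    | nil => exact one
    | append_singleton w a ih => rw [word_append, word_singleton]; exact mul _ _ ih
  | zero => simpa using smul 0 1 one
  | add A B _ _ hA hB => exact add A B hA hB
  | smul r A _ hA => exact smul r A hA

/-- Induction on `ℚ⟨V⟩`, words being built up by appending letters on the left. -/
theorem induction_left {p : QV → Prop} (one : p 1) (add : ∀ A B, p A → p B → p (A + B))
    (smul : ∀ (r : ℚ) A, p A → p (r • A)) (mul : ∀ k A, p A → p (v k * A)) (A : QV) : p A := by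
  have h : A ∈ Submodule.span ℚ (Set.range word) := span_word ▸ Submodule.mem_top
  induction h using Submodule.span_induction with
  | mem _ h =>
    obtain ⟨w, rfl⟩ := h
    induction w with
    | nil => exact one
    | cons a w ih => rw [word_cons]; exact mul _ _ ih
  | zero => simpa using smul 0 1 one
  | add A B _ _ hA hB => exact add A B hA hB
  | smul r A _ hA => exact smul r A hA

/-! ### Lie elements -/

theorem v_mem_lieV (s : ℕ) : v s ∈ LieV := LieSubalgebra.subset_lieSpan (Set.mem_range_self s)

theorem bracket_eq (x y : QV) : ⁅x, y⁆ = x * y - y * x := rfl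

/-- Elements of `Lie(V)` are primitive. -/
theorem co_of_mem_lieV {x : QV} (hx : x ∈ LieV) :
    co x = x ⊗ₜ[ℚ] (1 : QV) + (1 : QV) ⊗ₜ[ℚ] x := by
  induction hx using LieSubalgebra.lieSpan_induction with
  | mem x h => obtain ⟨s, rfl⟩ := h; exact co_v s
  | zero => simp
  | add x y _ _ hx hy =>
    rw [map_add, hx, hy]
    simp only [TensorProduct.add_tmul, TensorProduct.tmul_add]
    abel
  | smul a x _ hx => rw [map_smul, hx]; simp [TensorProduct.smul_tmul']
  | lie x y _ _ hx hy =>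
    rw [bracket_eq, map_sub, map_mul, map_mul, hx, hy]
    simp only [mul_add, add_mul, Algebra.TensorProduct.tmul_mul_tmul, one_mul, mul_one,
      TensorProduct.sub_tmul, TensorProduct.tmul_sub]
    abel

theorem counitHom_of_mem_lieV {x : QV} (hx : x ∈ LieV) : counitHom x = 0 := by
  induction hx using LieSubalgebra.lieSpan_induction with
  | mem x h => obtain ⟨s, rfl⟩ := h; exact counitHom_v s
  | zero => simp
  | add x y _ _ hx hy => rw [map_add, hx, hy, add_zero]
  | smul a x _ hx => rw [map_smul, hx, smul_zero]
  | lie x y _ _ hx hy => rw [bracket_eq, map_sub, map_mul, map_mul, mul_comm, sub_self]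

theorem lie_mem (x : MQ) : lie x ∈ LieV := (toLie x).2

theorem lie_map_add (x y : MQ) : lie (x + y) = lie x + lie y := by rw [lie, map_add]; rfl

theorem lie_map_smul (a : ℚ) (x : MQ) : lie (a • x) = a • lie x := by rw [lie, map_smul]; rfl

theorem lie_map_mul (x y : MQ) : lie (x * y) = lie x * lie y - lie y * lie x := by
  rw [lie, map_mul]
  rfl

theorem lie_of (s : ℕ) : lie (tree (.of s)) = v s := by
  have : toLie (tree (.of s)) = ⟨v s, v_mem_lieV s⟩ :=
    FreeNonUnitalNonAssocAlgebra.lift_of_apply _ _ _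
  rw [lie, this]
  rfl

theorem tree_mul (t u : FreeMagma ℕ) : tree (t * u) = tree t * tree u :=
  map_mul (MonoidAlgebra.ofMagma ℚ (FreeMagma ℕ)) t u

/-- `lie` as a linear map. -/
def lieLin : MQ →ₗ[ℚ] QV where
  toFun := lie
  map_add' := lie_map_add
  map_smul' := lie_map_smul

theorem lie_map_sum {ι : Type*} (s : Finset ι) (f : ι → MQ) :
    lie (∑ i ∈ s, f i) = ∑ i ∈ s, lie (f i) :=
  map_sum lieLin f s

/-- `Lie(V)` is spanned by the Lie monomials. -/
theorem mem_span_lie_tree {x : QV} (hx : x ∈ LieV) :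
    x ∈ Submodule.span ℚ (Set.range fun t => lie (tree t)) := by
  induction hx using LieSubalgebra.lieSpan_induction with
  | mem x h => obtain ⟨s, rfl⟩ := h; exact Submodule.subset_span ⟨.of s, lie_of s⟩
  | zero => exact Submodule.zero_mem _
  | add x y _ _ hx hy => exact Submodule.add_mem _ hx hy
  | smul a x _ hx => exact Submodule.smul_mem _ _ hx
  | lie x y hx' hy' hx hy =>
    clear hx' hy'
    induction hx using Submodule.span_induction with
    | mem x h =>
      obtain ⟨t, rfl⟩ := h
      induction hy using Submodule.span_induction with
      | mem x h =>
        obtain ⟨u, rfl⟩ := h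
        refine Submodule.subset_span ⟨t * u, ?_⟩
        simp only [tree_mul, lie_map_mul, bracket_eq]
      | zero => simp
      | add x y _ _ hx hy => rw [lie_add]; exact Submodule.add_mem _ hx hy
      | smul a x _ hx => rw [lie_smul]; exact Submodule.smul_mem _ _ hx
    | zero => simp
    | add x y _ _ hx hy => rw [add_lie]; exact Submodule.add_mem _ hx hy
    | smul a x _ hx => rw [smul_lie]; exact Submodule.smul_mem _ _ hx

section action

open Polynomial

/-! ### The shift morphism -/

/-- The coefficient `m_{k,l}` of a single letter. -/
def coef (k l : ℕ) : ℚ := (-1) ^ (k + l) * shiftedChoose k l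

theorem mult_eq_prod {ι : Type*} [Fintype ι] (k l : ι → ℕ) : mult k l = ∏ p, coef (k p) (l p) := by
  simp only [mult, coef, Finset.prod_mul_distrib, Finset.prod_pow_eq_pow_sum,
    Finset.sum_add_distrib]

/-- The algebra morphism `ℚ⟨V⟩ → ℚ⟨V⟩[X]` with `v_k ↦ ∑_l m_{k,l} v_l X^{k-l}`. -/
def shiftHom : QV →ₐ[ℚ] QV[X] :=
  FreeAlgebra.lift ℚ fun k => ∑ l ∈ Finset.Iic k, monomial (k - l) (coef k l • v l)

theorem shiftHom_v (k : ℕ) :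
    shiftHom (v k) = ∑ l ∈ Finset.Iic k, monomial (k - l) (coef k l • v l) := by
  simp [shiftHom, v]

/-- For a sequence `G` in `ℚ⟨V⟩`, the linear map `∑_j a_j X^j ↦ ∑_j [G (s + j), a_j]`. -/
def bracketEval (G : ℕ → QV) (s : ℕ) : QV[X] →ₗ[ℚ] QV :=
  lsum fun j => LinearMap.mulLeft ℚ (G (s + j)) - LinearMap.mulRight ℚ (G (s + j))

theorem bracketEval_monomial (G : ℕ → QV) (s j : ℕ) (a : QV) :
    bracketEval G s (monomial j a) = G (s + j) * a - a * G (s + j) := by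
  simp only [bracketEval, lsum_apply]
  rw [sum_monomial_index _ _ (by simp)]
  simp

theorem bracketEval_add (G H : ℕ → QV) (s : ℕ) (p : QV[X]) :
    bracketEval (G + H) s p = bracketEval G s p + bracketEval H s p := by
  induction p using Polynomial.induction_on' with
  | add p q hp hq => rw [map_add, map_add, map_add, hp, hq]; abel
  | monomial n a => simp only [bracketEval_monomial, Pi.add_apply]; noncomm_ring

theorem bracketEval_smul (r : ℚ) (G : ℕ → QV) (s : ℕ) (p : QV[X]) :
    bracketEval (r • G) s p = r • bracketEval G s p := by
  induction p using Polynomial.induction_on' with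
  | add p q hp hq => rw [map_add, map_add, hp, hq, smul_add]
  | monomial n a =>
    simp only [bracketEval_monomial, Pi.smul_apply, smul_mul_assoc, mul_smul_comm, smul_sub]

theorem bracketEval_congr {G H : ℕ → QV} {s : ℕ} (h : ∀ j, G (s + j) = H (s + j)) :
    bracketEval G s = bracketEval H s := by
  simp only [bracketEval, h]

/-- The Jacobi identity for `bracketEval`. -/
theorem bracketEval_commutator (G : ℕ → QV) (s : ℕ) (p q : QV[X]) :
    bracketEval (fun t => bracketEval G t p) s q - bracketEval (fun t => bracketEval G t q) s p =
      bracketEval G s (p * q - q * p) := by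
  induction p using Polynomial.induction_on' with
  | add p p' hp hp' =>
    have h1 : (fun t => bracketEval G t (p + p')) =
      (fun t => bracketEval G t p) + (fun t => bracketEval G t p') := by ext t; simp
    rw [h1, bracketEval_add, map_add, add_mul, mul_add, add_sub_add_comm, hp, hp', ← map_add]
    congr 1
    abel
  | monomial m a =>
    induction q using Polynomial.induction_on' with
    | add q q' hq hq' =>
      have h1 : (fun t => bracketEval G t (q + q')) =
        (fun t => bracketEval G t q) + (fun t => bracketEval G t q') := by ext t; simp
      rw [h1, bracketEval_add, map_add, add_mul, mul_add, add_sub_add_comm, hq, hq', ← map_add]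
      congr 1
      abel
    | monomial n b =>
      simp only [bracketEval_monomial, monomial_mul_monomial, map_sub, add_assoc, add_comm n m]
      noncomm_ring

/-! ### The action on letters -/

/-- The operator on sequences in `ℚ⟨V⟩` by which the letter `v_k` acts. The value at `0` is `0`
because `v_k ▷ v_0 = 0`. -/
def letterOp (k : ℕ) : Module.End ℚ (ℕ → QV) where
  toFun G s := if s = 0 then 0 else bracketEval G s (shiftHom (v k))
  map_add' G H := by
    ext s; by_cases hs : s = 0 <;> simp [hs, bracketEval_add]
  map_smul' r G := by
    ext s; by_cases hs : s = 0 <;> simp [hs, bracketEval_smul]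

theorem letterOp_apply (k : ℕ) (G : ℕ → QV) (s : ℕ) :
    letterOp k G s = if s = 0 then 0 else bracketEval G s (shiftHom (v k)) := rfl

/-- The right action of `ℚ⟨V⟩` on sequences in `ℚ⟨V⟩` for which `v_k` acts by `letterOp k`. -/
def seqOp : QV →ₐ[ℚ] (Module.End ℚ (ℕ → QV))ᵐᵒᵖ :=
  FreeAlgebra.lift ℚ fun k => MulOpposite.op (letterOp k)

/-- The operator by which `A` acts on sequences. -/
def act (A : QV) : Module.End ℚ (ℕ → QV) := (seqOp A).unop

theorem act_one : act 1 = 1 := by simp [act]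

theorem act_v (k : ℕ) : act (v k) = letterOp k := by simp [act, seqOp, v]

theorem act_mul (A B : QV) (G : ℕ → QV) : act (A * B) G = act B (act A G) := by simp [act]

theorem act_add (A B : QV) : act (A + B) = act A + act B := by simp [act]

theorem act_sub (A B : QV) : act (A - B) = act A - act B := by simp [act]

theorem act_smul (r : ℚ) (A : QV) : act (r • A) = r • act A := by simp [act]

/-- A Lie element `y` acts by the bracket with its image under the shift morphism. -/
theorem act_of_mem_lieV {y : QV} (hy : y ∈ LieV) (G : ℕ → QV) (s : ℕ) :
    act y G s = if s = 0 then 0 else bracketEval G s (shiftHom y) := by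
  induction hy using LieSubalgebra.lieSpan_induction generalizing G s with
  | mem x h => obtain ⟨k, rfl⟩ := h; rw [act_v, letterOp_apply]
  | zero => simp [act]
  | add x y _ _ hx hy =>
    rw [act_add, LinearMap.add_apply, Pi.add_apply, hx, hy]
    split_ifs <;> simp
  | smul a x _ hx =>
    rw [act_smul, LinearMap.smul_apply, Pi.smul_apply, hx]
    split_ifs <;> simp
  | lie x y _ _ hx hy =>
    rw [bracket_eq, act_sub, LinearMap.sub_apply, Pi.sub_apply, act_mul, act_mul, hx, hy]
    split_ifs with hs
    · simp
    · rw [map_sub, map_mul, map_mul, ← bracketEval_commutator]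
      congr 2 <;> refine bracketEval_congr fun j => ?_
      · rw [hx, if_neg (by omega)]
      · rw [hy, if_neg (by omega)]

/-- `A ↦ A ▷ v_s`: the value at `s` of the result of `A` acting on the sequence of letters. -/
def letterTriangle (s : ℕ) : QV →ₗ[ℚ] QV where
  toFun A := act A v s
  map_add' A B := by simp [act_add]
  map_smul' r A := by simp [act_smul]

theorem letterTriangle_apply (s : ℕ) (A : QV) : letterTriangle s A = act A v s := rfl

open WithConv in
/-- `B ↦ (A ↦ A ▷ B)` as an algebra morphism to the convolution algebra. -/
def triangleHom : QV →ₐ[ℚ] WithConv (QV →ₗ[ℚ] QV) :=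
  FreeAlgebra.lift ℚ fun s => toConv (letterTriangle s)

theorem triangleHom_v (s : ℕ) : (triangleHom (v s)).ofConv = letterTriangle s := by
  simp [triangleHom, v]

/-- The extension of the ari post-Lie product to `ℚ⟨V⟩`. -/
def ariTriangle : QV →ₗ[ℚ] QV →ₗ[ℚ] QV :=
  LinearMap.flip
    { toFun := fun B => (triangleHom B).ofConv
      map_add' := fun B C => by simp
      map_smul' := fun r B => by simp }

theorem ariTriangle_apply (A B : QV) : ariTriangle A B = (triangleHom B).ofConv A := rfl

theorem ariTriangle_v (A : QV) (s : ℕ) : ariTriangle A (v s) = act A v s := by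
  rw [ariTriangle_apply, triangleHom_v, letterTriangle_apply]

theorem ariTriangle_mul (A B C : QV) : ariTriangle A (B * C) = sweedlerMul ariTriangle A B C := by
  rw [ariTriangle_apply, map_mul]
  rfl

theorem ariTriangle_right_one (A : QV) : ariTriangle A 1 = algebraMap ℚ QV (counitHom A) := by
  rw [ariTriangle_apply, map_one]
  rfl

theorem sweedlerMul_of_mem_lieV (T : QV →ₗ[ℚ] QV →ₗ[ℚ] QV) {x : QV} (hx : x ∈ LieV) (B C : QV) :
    sweedlerMul T x B C = T x B * T 1 C + T 1 B * T x C := by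
  simp [sweedlerMul, co_of_mem_lieV hx]

theorem ariTriangle_one_left (A : QV) : ariTriangle 1 A = A := by
  induction A using induction_right with
  | one => rw [ariTriangle_right_one, map_one, map_one]
  | add A B hA hB => rw [map_add, hA, hB]
  | smul r A hA => rw [map_smul, hA]
  | mul A k hA =>
    rw [ariTriangle_mul, sweedlerMul, map_one, Algebra.TensorProduct.one_def]
    simp [hA, ariTriangle_v, act_one]

theorem ariTriangle_mul_of_mem_lieV {x : QV} (hx : x ∈ LieV) (B C : QV) :
    ariTriangle x (B * C) = ariTriangle x B * C + B * ariTriangle x C := by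
  rw [ariTriangle_mul, sweedlerMul_of_mem_lieV _ hx, ariTriangle_one_left, ariTriangle_one_left]

theorem ariTriangle_one_of_mem_lieV {x : QV} (hx : x ∈ LieV) : ariTriangle x 1 = 0 := by
  rw [ariTriangle_right_one, counitHom_of_mem_lieV hx, map_zero]

/-! ### Comparison with the triangle on the free magma -/

theorem sum_Iic_append {M : Type*} [AddCommMonoid M] {m n : ℕ} (a : Fin m → ℕ) (b : Fin n → ℕ)
    (f : (Fin (m + n) → ℕ) → M) :
    ∑ l ∈ Finset.Iic (Fin.append a b), f l =
      ∑ x ∈ Finset.Iic a, ∑ y ∈ Finset.Iic b, f (Fin.append x y) := by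
  rw [← Finset.sum_product']
  refine Finset.sum_nbij' (fun l => (fun p => l (Fin.castAdd n p), fun p => l (Fin.natAdd m p)))
    (fun xy => Fin.append xy.1 xy.2) ?_ ?_ ?_ ?_ ?_
  · intro l hl
    simp only [Finset.mem_Iic, Finset.mem_product, Pi.le_def] at hl ⊢
    exact ⟨fun p => by simpa using hl (Fin.castAdd n p),
      fun p => by simpa using hl (Fin.natAdd m p)⟩
  · rintro ⟨x, y⟩ h
    simp only [Finset.mem_Iic, Finset.mem_product, Pi.le_def] at h ⊢
    intro p
    induction p using Fin.addCases with
    | left p => simpa using h.1 p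
    | right p => simpa using h.2 p
  · intro l _
    exact Fin.append_castAdd_natAdd
  · rintro ⟨x, y⟩ _
    simp
  · intro l _
    exact congrArg f Fin.append_castAdd_natAdd.symm

theorem mult_append {m n : ℕ} (a x : Fin m → ℕ) (b y : Fin n → ℕ) :
    mult (Fin.append a b) (Fin.append x y) = mult a x * mult b y := by
  simp [mult_eq_prod, Fin.prod_univ_add]

/-- The shift morphism on a Lie monomial is given by the ari multiplicities. -/
theorem shiftHom_lie_tree (t : FreeMagma ℕ) :
    shiftHom (lie (tree t)) = ∑ l ∈ Finset.Iic (labels t),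
      monomial (∑ p, (labels t p - l p)) (mult (labels t) l • lie (tree (relabel t l))) := by
  induction t with
  | ih1 s =>
    rw [lie_of, shiftHom_v]
    refine Finset.sum_nbij' (fun l _ => l) (fun l => l ⟨0, Nat.one_pos⟩) ?_ ?_ ?_ ?_ ?_
    · intro l hl
      exact Finset.mem_Iic.2 fun _ => Finset.mem_Iic.1 hl
    · intro l hl
      simp only [Finset.mem_Iic] at hl ⊢
      exact hl _
    · intro l _
      rfl
    · intro l _
      funext p
      exact congrArg l (Subsingleton.elim (α := Fin 1) _ _)
    · intro l _
      change _ = monomial (∑ p : Fin 1, (s - l))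
        (mult (fun _ : Fin 1 => s) (fun _ : Fin 1 => l) • lie (tree (.of l)))
      rw [mult_eq_prod, Fin.sum_univ_one, Fin.prod_univ_one, lie_of]
  | ih2 t u iht ihu =>
    change shiftHom (lie (tree (t * u))) = ∑ l ∈ Finset.Iic (Fin.append (labels t) (labels u)),
      monomial (∑ p : Fin (t.length + u.length), (Fin.append (labels t) (labels u) p - l p))
        (mult (Fin.append (labels t) (labels u)) l •
          lie (tree (relabel t (fun p => l (Fin.castAdd u.length p)) *
            relabel u (fun p => l (Fin.natAdd t.length p)))))
    rw [sum_Iic_append, tree_mul, lie_map_mul, map_sub, map_mul, map_mul, iht, ihu,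
      Finset.sum_mul_sum, Finset.sum_mul_sum, Finset.sum_comm (s := Finset.Iic (labels u)),
      ← Finset.sum_sub_distrib]
    refine Finset.sum_congr rfl fun x _ => ?_
    rw [← Finset.sum_sub_distrib]
    refine Finset.sum_congr rfl fun y _ => ?_
    simp only [monomial_mul_monomial, Fin.sum_univ_add, Fin.append_left, Fin.append_right,
      mult_append, tree_mul, lie_map_mul]
    rw [add_comm (∑ p, (labels u p - y p)), ← map_sub]
    congr 1
    simp only [smul_mul_assoc, mul_smul_comm, smul_smul, smul_sub]
    rw [mul_comm (mult (labels u) y)]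

theorem ariTriangle_on_lie (t u : FreeMagma ℕ) :
    ariTriangle (lie (tree t)) (lie (tree u)) = lie (triangleMagma t u) := by
  induction u with
  | ih1 s =>
    rw [lie_of, ariTriangle_v, act_of_mem_lieV (lie_mem _)]
    simp only [triangleMagma]
    split_ifs with hs
    · exact (map_zero lieLin).symm
    · rw [shiftHom_lie_tree, map_sum, lie_map_sum]
      refine Finset.sum_congr rfl fun l _ => ?_
      rw [bracketEval_monomial, lie_map_smul, lie_map_mul, lie_of]
      simp only [smul_sub, mul_smul_comm, smul_mul_assoc]
  | ih2 u w ihu ihw =>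
    change ariTriangle (lie (tree t)) (lie (tree (u * w))) =
      lie (triangleMagma t u * tree w + tree u * triangleMagma t w)
    rw [tree_mul, lie_map_mul, map_sub, ariTriangle_mul_of_mem_lieV (lie_mem _),
      ariTriangle_mul_of_mem_lieV (lie_mem _), ihu, ihw, lie_map_add, lie_map_mul, lie_map_mul]
    noncomm_ring

/-- A bilinear map which is given on Lie monomials by the triangle of the free magma maps pairs of
elements of `Lie(V)` to `Lie(V)`. -/
theorem mem_lieV_of_on_lie {T : QV →ₗ[ℚ] QV →ₗ[ℚ] QV}
    (hT : ∀ t u, T (lie (tree t)) (lie (tree u)) = lie (triangleMagma t u)) {x y : QV}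
    (hx : x ∈ LieV) (hy : y ∈ LieV) : T x y ∈ LieV := by
  replace hx := mem_span_lie_tree hx
  replace hy := mem_span_lie_tree hy
  induction hx using Submodule.span_induction with
  | mem x h =>
    obtain ⟨t, rfl⟩ := h
    induction hy using Submodule.span_induction with
    | mem x h =>
      obtain ⟨u, rfl⟩ := h
      rw [hT]
      exact lie_mem _
    | zero => rw [map_zero]; exact LieV.zero_mem
    | add x y _ _ hx hy => rw [map_add]; exact LieV.add_mem hx hy
    | smul a x _ hx => rw [map_smul]; exact LieV.smul_mem _ hx
  | zero => rw [map_zero]; exact LieV.zero_mem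
  | add x y _ _ hx hy => rw [map_add]; exact LieV.add_mem hx hy
  | smul a x _ hx => rw [map_smul]; exact LieV.smul_mem _ hx

theorem ariTriangle_mem_lieV {x y : QV} (hx : x ∈ LieV) (hy : y ∈ LieV) : ariTriangle x y ∈ LieV :=
  mem_lieV_of_on_lie ariTriangle_on_lie hx hy

/-! ### Derivations commute with the shift -/

/-- Linear endomorphisms of `ℚ⟨V⟩` satisfying the Leibniz rule. -/
def IsDer (δ : QV →ₗ[ℚ] QV) : Prop := ∀ A B, δ (A * B) = δ A * B + A * δ B

theorem IsDer.one {δ : QV →ₗ[ℚ] QV} (h : IsDer δ) : δ 1 = 0 := by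
  have := h 1 1
  rw [one_mul, mul_one, one_mul] at this
  exact left_eq_add.mp this

theorem IsDer.comp_sub_comp {δ ε : QV →ₗ[ℚ] QV} (hδ : IsDer δ) (hε : IsDer ε) :
    IsDer (δ ∘ₗ ε - ε ∘ₗ δ) := by
  intro A B
  simp only [LinearMap.sub_apply, LinearMap.comp_apply, hδ _ _, hε _ _, map_add]
  noncomm_ring

theorem IsDer.eq_zero {δ : QV →ₗ[ℚ] QV} (h : IsDer δ) (hv : ∀ s, δ (v s) = 0) : δ = 0 := by
  ext A
  induction A using induction_right with
  | one => rw [h.one]; rfl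
  | add A B hA hB => rw [map_add, hA, hB]; simp
  | smul r A hA => rw [map_smul, hA]; simp
  | mul A k hA => rw [h, hA, hv]; simp

/-- Action of a linear endomorphism on coefficients. -/
def mapCoeff (δ : QV →ₗ[ℚ] QV) : QV[X] →ₗ[ℚ] QV[X] :=
  lsum fun j => ((monomial j).restrictScalars ℚ : QV →ₗ[ℚ] QV[X]) ∘ₗ δ

theorem mapCoeff_monomial (δ : QV →ₗ[ℚ] QV) (j : ℕ) (a : QV) :
    mapCoeff δ (monomial j a) = monomial j (δ a) := by
  simp only [mapCoeff, lsum_apply]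
  rw [sum_monomial_index _ _ (by simp)]
  simp

theorem coeff_mapCoeff (δ : QV →ₗ[ℚ] QV) (p : QV[X]) (j : ℕ) :
    (mapCoeff δ p).coeff j = δ (p.coeff j) := by
  induction p using Polynomial.induction_on' with
  | add p q hp hq => simp [hp, hq]
  | monomial n a =>
    rw [mapCoeff_monomial, coeff_monomial, coeff_monomial]
    split_ifs <;> simp

/-- The derivation of `ℚ⟨V⟩` with `v_k ↦ -(k-1) v_{k-1}` for `k ≥ 1` and `v_0 ↦ 0`; it is the
infinitesimal generator of the shift morphism. -/
def lowering : QV →ₗ[ℚ] QV := (lcoeff QV 1).restrictScalars ℚ ∘ₗ shiftHom.toLinearMap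

theorem lowering_apply (A : QV) : lowering A = (shiftHom A).coeff 1 := rfl

theorem coef_self (k : ℕ) : coef k k = 1 := by
  have : shiftedChoose k k = 1 := by
    cases k with
    | zero => rfl
    | succ k => exact Nat.choose_self k
  rw [coef, this, ← two_mul, pow_mul]
  simp

theorem coeff_shiftHom_v (k j : ℕ) :
    (shiftHom (v k)).coeff j = if j ≤ k then coef k (k - j) • v (k - j) else 0 := by
  rw [shiftHom_v, finsetSum_coeff]
  simp only [coeff_monomial]
  split_ifs with h
  · rw [Finset.sum_eq_single (k - j), if_pos (by omega)]
    · intro l hl hne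
      rw [Finset.mem_Iic] at hl
      exact if_neg (by omega)
    · intro hn
      exact absurd (Finset.mem_Iic.2 (Nat.sub_le k j)) hn
  · refine Finset.sum_eq_zero fun l hl => if_neg (by omega)

theorem coeff_zero_shiftHom (A : QV) : (shiftHom A).coeff 0 = A := by
  induction A using induction_right with
  | one => simp
  | add A B hA hB => simp [hA, hB]
  | smul r A hA => simp [hA]
  | mul A k hA => rw [map_mul, mul_coeff_zero, hA, coeff_shiftHom_v]; simp [coef_self]

theorem isDer_lowering : IsDer lowering := by
  intro A B
  simp only [lowering_apply, map_mul, coeff_mul, Finset.Nat.antidiagonal_succ]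
  simp [coeff_zero_shiftHom, add_comm]

theorem lowering_v (k : ℕ) : lowering (v k) = -((k - 1 : ℕ) : ℚ) • v (k - 1) := by
  rw [lowering_apply, coeff_shiftHom_v]
  match k with
  | 0 => simp
  | 1 => simp [coef, shiftedChoose]
  | k + 2 =>
    rw [if_pos (by omega)]
    congr 1
    simp [coef, shiftedChoose, pow_add, pow_succ]
    rw [← mul_pow]
    simp

theorem coef_pred_mul {k j : ℕ} (h : j + 1 ≤ k) :
    coef k (k - (j + 1)) * (j + 1) = -((k - 1 : ℕ) : ℚ) * coef (k - 1) (k - 1 - j) := by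
  obtain ⟨r, rfl⟩ := Nat.exists_eq_add_of_le h
  rw [Nat.add_sub_cancel_left, show j + 1 + r - 1 = j + r by omega, Nat.add_sub_cancel_left]
  match r with
  | 0 =>
    cases j with
    | zero => simp [coef, shiftedChoose]
    | succ j => simp [coef, shiftedChoose]
  | r + 1 =>
    have h1 : ((j + r + 1).choose r : ℚ) * (j + 1) = (j + r + 1) * (j + r).choose r := by
      have := Nat.add_one_mul_choose_eq (j + r) j
      rw [Nat.choose_symm_add, ← Nat.choose_symm_of_eq_add (show j + r + 1 = r + (j + 1) by omega)]
        at this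
      exact_mod_cast this.symm
    have h2 : shiftedChoose (j + 1 + (r + 1)) (r + 1) = (j + r + 1).choose r := by
      rw [show j + 1 + (r + 1) = (j + r + 1) + 1 by omega]
      rfl
    have h3 : shiftedChoose (j + (r + 1)) (r + 1) = (j + r).choose r := rfl
    rw [coef, coef, h2, h3, mul_assoc, h1]
    push_cast
    ring

/-- The shift morphism is the exponential of `X` times `lowering`. -/
theorem derivative_shiftHom (A : QV) : derivative (shiftHom A) = shiftHom (lowering A) := by
  induction A using induction_right with
  | one => simp [isDer_lowering.one]
  | add A B hA hB => simp [hA, hB]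
  | smul r A hA =>
    rw [map_smul, map_smul (lowering), map_smul shiftHom, ← hA]
    exact derivative_smul _ _
  | mul A k hA =>
    rw [isDer_lowering, map_mul shiftHom, map_add, map_mul shiftHom, map_mul shiftHom,
      derivative_mul, hA]
    congr 2
    rw [lowering_v, map_smul]
    ext1 j
    rw [coeff_derivative, coeff_smul, coeff_shiftHom_v, coeff_shiftHom_v]
    by_cases h : j + 1 ≤ k
    · rw [if_pos h, if_pos (by omega), smul_smul, ← coef_pred_mul h,
        show k - (j + 1) = k - 1 - j by omega, mul_comm (coef _ _), mul_smul,
        show ((j : QV) + 1) = algebraMap ℚ QV (j + 1) by simp, ← Algebra.commutes,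
        ← Algebra.smul_def]
    · rw [if_neg h, zero_mul]
      rcases Nat.eq_zero_or_pos k with rfl | hk
      · simp
      · rw [if_neg (by omega), smul_zero]

/-- An endomorphism which commutes with `lowering` commutes with the shift morphism. -/
theorem mapCoeff_shiftHom {δ : QV →ₗ[ℚ] QV} (h : ∀ A, δ (lowering A) = lowering (δ A)) (A : QV) :
    mapCoeff δ (shiftHom A) = shiftHom (δ A) := by
  ext1 j
  rw [coeff_mapCoeff]
  induction j generalizing A with
  | zero => rw [coeff_zero_shiftHom, coeff_zero_shiftHom]
  | succ j ih =>
    have key (B : QV) : ((j : ℚ) + 1) • (shiftHom B).coeff (j + 1) =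
        (shiftHom (lowering B)).coeff j := by
      rw [← derivative_shiftHom, coeff_derivative,
        show ((j : QV) + 1) = algebraMap ℚ QV (j + 1) by simp, ← Algebra.commutes,
        ← Algebra.smul_def]
    have hj : (j : ℚ) + 1 ≠ 0 := by positivity
    apply smul_right_injective QV hj
    simp only
    rw [← map_smul, key, key, ih, h]

/-- Moving `lowering` through `bracketEval` on the sequence of letters: the factor `s + j - 1` from
`v_{s+j}` splits into `s - 1` and the factor `j` of the derivative in `X`. -/
theorem lowering_bracketEval {s : ℕ} (hs : s ≠ 0) (p : QV[X]) :
    lowering (bracketEval v s p) = -((s - 1 : ℕ) : ℚ) • bracketEval v (s - 1) p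
      - bracketEval v s (derivative p) + bracketEval v s (mapCoeff lowering p) := by
  obtain ⟨s, rfl⟩ := Nat.exists_eq_succ_of_ne_zero hs
  induction p using Polynomial.induction_on' with
  | add p q hp hq => simp only [map_add, hp, hq, smul_add]; abel
  | monomial j a =>
    have h1 : bracketEval v (s + 1) (derivative (monomial j a)) =
        (j : ℚ) • (v (s + j) * a - a * v (s + j)) := by
      rw [derivative_monomial, bracketEval_monomial, show (j : QV) = algebraMap ℚ QV j by simp,
        ← Algebra.commutes, ← Algebra.smul_def]
      cases j with
      | zero => simp
      | succ j =>
        rw [show s + 1 + (j + 1 - 1) = s + (j + 1) by omega]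
        simp [smul_sub]
    rw [Nat.succ_eq_add_one, h1, mapCoeff_monomial, bracketEval_monomial, bracketEval_monomial,
      bracketEval_monomial, map_sub, isDer_lowering, isDer_lowering, lowering_v,
      show s + 1 + j - 1 = s + j by omega, Nat.add_sub_cancel]
    simp only [smul_sub, neg_smul, neg_mul, mul_neg, Nat.cast_add, add_smul, add_mul, mul_add,
      smul_mul_assoc, mul_smul_comm]
    abel

theorem isDer_ariTriangle {x : QV} (hx : x ∈ LieV) : IsDer (ariTriangle x) :=
  ariTriangle_mul_of_mem_lieV hx

/-- For `s ≥ 1` the contributions of the shift of `x` and of the shift of the letter cancel. -/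
theorem ariTriangle_lowering {x : QV} (hx : x ∈ LieV) (A : QV) :
    ariTriangle x (lowering A) = lowering (ariTriangle x A) := by
  have h := ((isDer_ariTriangle hx).comp_sub_comp isDer_lowering).eq_zero fun s => by
    rw [LinearMap.sub_apply, LinearMap.comp_apply, LinearMap.comp_apply, lowering_v, map_smul,
      ariTriangle_v, ariTriangle_v, act_of_mem_lieV hx, act_of_mem_lieV hx]
    by_cases hs : s = 0
    · simp [hs]
    · rw [if_neg hs, lowering_bracketEval hs, mapCoeff_shiftHom (fun _ => rfl),
        derivative_shiftHom, sub_add_cancel]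
      by_cases hs' : s - 1 = 0
      · simp [hs']
      · rw [if_neg hs', sub_self]
  exact sub_eq_zero.1 (LinearMap.congr_fun h A)

/-! ### The post-Lie identity -/

theorem IsDer.bracketEval {δ : QV →ₗ[ℚ] QV} (h : IsDer δ) (G : ℕ → QV) (s : ℕ) (p : QV[X]) :
    δ (bracketEval G s p) = Ari.bracketEval (δ ∘ G) s p + Ari.bracketEval G s (mapCoeff δ p) := by
  induction p using Polynomial.induction_on' with
  | add p q hp hq => simp only [map_add, hp, hq]; abel
  | monomial j a =>
    simp only [mapCoeff_monomial, bracketEval_monomial, map_sub, h _ _, Function.comp_apply]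
    abel

/-- The post-Lie identity for the action on letters. -/
theorem act_mul_of_mem_lieV {x : QV} (hx : x ∈ LieV) (A : QV) :
    act (x * A) v = ariTriangle x ∘ act A v - act (ariTriangle x A) v := by
  induction A using induction_right with
  | one =>
    rw [mul_one, ariTriangle_one_of_mem_lieV hx]
    ext s
    simp [ariTriangle_v, act]
  | add A B hA hB =>
    rw [mul_add, act_add, LinearMap.add_apply, hA, hB, map_add, act_add, act_add]
    ext s
    simp
    abel
  | smul r A hA =>
    rw [mul_smul_comm, act_smul, LinearMap.smul_apply, hA, map_smul, act_smul, act_smul]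
    ext s
    simp [smul_sub]
  | mul A k hA =>
    rw [← mul_assoc, act_mul, hA, map_sub, isDer_ariTriangle hx, act_add, LinearMap.add_apply,
      act_mul, act_mul, act_mul, act_v]
    ext s
    -- Commuting `x ▷ ·` with the operator of `v_k` produces the bracket with the image of
    -- `x ▷ v_k` under the shift morphism, which is the action of the Lie element `x ▷ v_k`.
    have hk := act_of_mem_lieV (ariTriangle_mem_lieV hx (v_mem_lieV k)) (act A v) s
    simp only [Pi.sub_apply, Pi.add_apply, Function.comp_apply, hk]
    simp only [letterOp_apply]
    split_ifs
    · simp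
    · rw [(isDer_ariTriangle hx).bracketEval, mapCoeff_shiftHom (ariTriangle_lowering hx)]
      abel

/-- `A ↦ x A + x ▷ A`; for `x ∈ Lie(V)` this is the Grossman–Larson product with `x`. -/
def glLeft (x : QV) : QV →ₗ[ℚ] QV := LinearMap.mulLeft ℚ x + ariTriangle x

/-- The action of a Lie element is a coderivation. -/
theorem co_ariTriangle {x : QV} (hx : x ∈ LieV) (A : QV) :
    co (ariTriangle x A) =
      (ariTriangle x).rTensor QV (co A) + (ariTriangle x).lTensor QV (co A) := by
  have h (X Y : QV ⊗[ℚ] QV) (δ : QV →ₗ[ℚ] QV) (hδ : IsDer δ) :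
      δ.rTensor QV (X * Y) = δ.rTensor QV X * Y + X * δ.rTensor QV Y := by
    induction X with
    | zero => simp
    | add X X' hX hX' => rw [add_mul, map_add, hX, hX', map_add]; noncomm_ring
    | tmul a b =>
      induction Y with
      | zero => simp
      | add Y Y' hY hY' => rw [mul_add, map_add, hY, hY', map_add]; noncomm_ring
      | tmul c d => simp [hδ a c, TensorProduct.add_tmul]
  have h' (X Y : QV ⊗[ℚ] QV) (δ : QV →ₗ[ℚ] QV) (hδ : IsDer δ) :
      δ.lTensor QV (X * Y) = δ.lTensor QV X * Y + X * δ.lTensor QV Y := by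
    induction X with
    | zero => simp
    | add X X' hX hX' => rw [add_mul, map_add, hX, hX', map_add]; noncomm_ring
    | tmul a b =>
      induction Y with
      | zero => simp
      | add Y Y' hY hY' => rw [mul_add, map_add, hY, hY', map_add]; noncomm_ring
      | tmul c d => simp [hδ b d, TensorProduct.tmul_add]
  have hδ := isDer_ariTriangle hx
  induction A using induction_right with
  | one => simp [hδ.one, Algebra.TensorProduct.one_def]
  | add A B hA hB => simp only [map_add, hA, hB]; abel
  | smul r A hA => simp only [map_smul, hA, smul_add]
  | mul A k hA =>
    have hk := co_of_mem_lieV (ariTriangle_mem_lieV hx (v_mem_lieV k))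
    rw [hδ, map_add, map_mul, map_mul, map_mul, hA, h _ _ _ hδ, h' _ _ _ hδ, hk, co_v]
    simp [hδ.one]
    noncomm_ring

/-- `glLeft x` is a coderivation if `x` is a Lie element. -/
theorem co_glLeft {x : QV} (hx : x ∈ LieV) (A : QV) :
    co (glLeft x A) = (glLeft x).rTensor QV (co A) + (glLeft x).lTensor QV (co A) := by
  have h1 (X : QV ⊗[ℚ] QV) : x ⊗ₜ[ℚ] (1 : QV) * X = (LinearMap.mulLeft ℚ x).rTensor QV X := by
    induction X with
    | zero => simp
    | add X Y hX hY => rw [mul_add, hX, hY, map_add]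
    | tmul a b => simp
  have h2 (X : QV ⊗[ℚ] QV) : (1 : QV) ⊗ₜ[ℚ] x * X = (LinearMap.mulLeft ℚ x).lTensor QV X := by
    induction X with
    | zero => simp
    | add X Y hX hY => rw [mul_add, hX, hY, map_add]
    | tmul a b => simp
  simp only [glLeft, LinearMap.add_apply, LinearMap.mulLeft_apply, map_add, map_mul,
    co_ariTriangle hx, co_of_mem_lieV hx, add_mul, h1, h2, LinearMap.rTensor_add,
    LinearMap.lTensor_add]
  abel

/-- The action of a Lie element after that of `A` is the action of `x A + x ▷ A`. -/
theorem ariTriangle_glLeft {x : QV} (hx : x ∈ LieV) (A B : QV) :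
    ariTriangle (glLeft x A) B = ariTriangle x (ariTriangle A B) := by
  induction B using induction_right generalizing A with
  | one =>
    rw [ariTriangle_right_one, ariTriangle_right_one, glLeft, LinearMap.add_apply,
      LinearMap.mulLeft_apply, map_add, map_mul, counitHom_of_mem_lieV hx, zero_mul, zero_add,
      Algebra.algebraMap_eq_smul_one (counitHom A), map_smul, ariTriangle_one_of_mem_lieV hx,
      smul_zero]
    have h2 : (algebraMap ℚ QV) (counitHom (ariTriangle x A)) = 0 := by
      induction A using induction_right with
      | one => simp [(isDer_ariTriangle hx).one]
      | add A B hA hB => simp [hA, hB]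
      | smul r A hA => simp [hA]
      | mul A k hA =>
        rw [isDer_ariTriangle hx, map_add, map_mul, map_mul, counitHom_v,
          counitHom_of_mem_lieV (ariTriangle_mem_lieV hx (v_mem_lieV k))]
        simp
    exact h2
  | add B C hB hC => simp only [map_add, hB, hC]
  | smul r B hB => simp only [map_smul, hB]
  | mul B k hB =>
    have hv (A : QV) : ariTriangle (glLeft x A) (v k) = ariTriangle x (ariTriangle A (v k)) := by
      rw [ariTriangle_v, ariTriangle_v, glLeft, LinearMap.add_apply, act_add,
        LinearMap.mulLeft_apply, LinearMap.add_apply, act_mul_of_mem_lieV hx, sub_add_cancel]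
      rfl
    rw [ariTriangle_mul, ariTriangle_mul, sweedlerMul, sweedlerMul, co_glLeft hx]
    generalize co A = X
    induction X with
    | zero => simp
    | add X Y hX hY =>
      simp only [map_add] at hX hY ⊢
      rw [← hX, ← hY]
      abel
    | tmul a b =>
      simp only [map_add, LinearMap.rTensor_tmul, LinearMap.lTensor_tmul, TensorProduct.map_tmul,
        LinearMap.mul'_apply, LinearMap.flip_apply, hB, hv, isDer_ariTriangle hx _ _]

theorem isAriTriangle_ariTriangle : IsAriTriangle ariTriangle where
  on_lie := ariTriangle_on_lie
  lie_one _ hx := ariTriangle_one_of_mem_lieV hx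
  one_left := ariTriangle_one_left
  mul_left x hx A y _ := by
    rw [← ariTriangle_glLeft hx, glLeft, LinearMap.add_apply, LinearMap.mulLeft_apply, map_add,
      LinearMap.add_apply, add_sub_cancel_right]
  mul_right := ariTriangle_mul

end action

/-! ### Uniqueness of the triangle -/

/-- The span of the products of `n` elements of `Lie(V)`. -/
def lieProducts (n : ℕ) : Submodule ℚ QV :=
  Submodule.span ℚ {A | ∃ l : List QV, (∀ x ∈ l, x ∈ LieV) ∧ l.length = n ∧ l.prod = A}

theorem mul_mem_lieProducts {n : ℕ} {x A : QV} (hx : x ∈ LieV) (hA : A ∈ lieProducts n) :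
    x * A ∈ lieProducts (n + 1) := by
  induction hA using Submodule.span_induction with
  | mem A h =>
    obtain ⟨l, hl, rfl, rfl⟩ := h
    exact Submodule.subset_span ⟨x :: l, by simpa using ⟨hx, hl⟩, rfl, List.prod_cons⟩
  | zero => simp
  | add A B _ _ hA hB => rw [mul_add]; exact Submodule.add_mem _ hA hB
  | smul r A _ hA => rw [mul_smul_comm]; exact Submodule.smul_mem _ _ hA

theorem IsDer.prod_mem_lieProducts {δ : QV →ₗ[ℚ] QV} (h : IsDer δ)
    (hδ : ∀ x ∈ LieV, δ x ∈ LieV) {l : List QV} (hl : ∀ x ∈ l, x ∈ LieV) :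
    δ l.prod ∈ lieProducts l.length := by
  induction l with
  | nil => simp [h.one]
  | cons x l ih =>
    have hx := hl x (by simp)
    have hl' : ∀ y ∈ l, y ∈ LieV := fun y hy => hl y (by simp [hy])
    rw [List.prod_cons, h]
    exact Submodule.add_mem _
      (mul_mem_lieProducts (hδ x hx) (Submodule.subset_span ⟨l, hl', rfl, rfl⟩))
      (mul_mem_lieProducts hx (ih hl'))

namespace IsAriTriangle

variable {T : QV →ₗ[ℚ] QV →ₗ[ℚ] QV}

theorem isDer (hT : IsAriTriangle T) {x : QV} (hx : x ∈ LieV) : IsDer (T x) := by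
  intro A B
  rw [hT.mul_right, sweedlerMul_of_mem_lieV _ hx, hT.one_left, hT.one_left]

theorem eq_on_lieV (hT : IsAriTriangle T) {x y : QV} (hx : x ∈ LieV) (hy : y ∈ LieV) :
    T x y = ariTriangle x y := by
  replace hx := mem_span_lie_tree hx
  replace hy := mem_span_lie_tree hy
  induction hx using Submodule.span_induction with
  | mem x h =>
    obtain ⟨t, rfl⟩ := h
    induction hy using Submodule.span_induction with
    | mem x h => obtain ⟨u, rfl⟩ := h; rw [hT.on_lie, ariTriangle_on_lie]
    | zero => simp
    | add x y _ _ hx hy => rw [map_add, map_add, hx, hy]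
    | smul a x _ hx => rw [map_smul, map_smul, hx]
  | zero => simp
  | add x y _ _ hx hy => simp [hx, hy]
  | smul a x _ hx => simp [hx]

theorem apply_of_mem_lieV (hT : IsAriTriangle T) {x : QV} (hx : x ∈ LieV) :
    T x = ariTriangle x := by
  refine sub_eq_zero.1 (IsDer.eq_zero (fun A B => ?_) fun s => ?_)
  · simp only [LinearMap.sub_apply, hT.isDer hx A B, isDer_ariTriangle hx A B]
    noncomm_ring
  · rw [LinearMap.sub_apply, hT.eq_on_lieV hx (v_mem_lieV s), sub_self]

/-- The rule for `(x A) ▷ y` reduces a product of `n + 1` Lie elements to products of `n` of them,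
as `x ▷ ·` is a derivation preserving `Lie(V)`. -/
theorem eq_on_lieProducts (hT : IsAriTriangle T) {n : ℕ} {A y : QV} (hA : A ∈ lieProducts n)
    (hy : y ∈ LieV) : T A y = ariTriangle A y ∧ ariTriangle A y ∈ LieV := by
  induction n generalizing A y with
  | zero =>
    induction hA using Submodule.span_induction with
    | mem A h =>
      obtain ⟨l, _, hl, rfl⟩ := h
      obtain rfl := List.length_eq_zero_iff.1 hl
      rw [List.prod_nil, hT.one_left, ariTriangle_one_left]
      exact ⟨rfl, hy⟩
    | zero => simp
    | add A B _ _ hA hB => simpa [hA.1, hB.1] using LieV.add_mem hA.2 hB.2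
    | smul r A _ hA => simpa [hA.1] using LieV.smul_mem r hA.2
  | succ n ih =>
    induction hA using Submodule.span_induction with
    | mem A h =>
      obtain ⟨l, hl, hn, rfl⟩ := h
      obtain ⟨x, l, rfl⟩ := List.exists_cons_of_length_eq_add_one hn
      have hx := hl x (by simp)
      have hl' : ∀ y ∈ l, y ∈ LieV := fun y hy => hl y (by simp [hy])
      obtain rfl : l.length = n := by simpa using hn
      have h1 := ih (Submodule.subset_span ⟨l, hl', rfl, rfl⟩) hy
      have h2 := ih ((isDer_ariTriangle hx).prod_mem_lieProducts
        (fun _ => ariTriangle_mem_lieV hx) hl') hy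
      rw [List.prod_cons, hT.mul_left x hx _ y hy,
        isAriTriangle_ariTriangle.mul_left x hx _ y hy, hT.apply_of_mem_lieV hx, h1.1, h2.1]
      exact ⟨rfl, LieV.sub_mem (ariTriangle_mem_lieV hx h1.2) h2.2⟩
    | zero => simp
    | add A B _ _ hA hB => simpa [hA.1, hB.1] using LieV.add_mem hA.2 hB.2
    | smul r A _ hA => simpa [hA.1] using LieV.smul_mem r hA.2

theorem flip_v (hT : IsAriTriangle T) (s : ℕ) : T.flip (v s) = ariTriangle.flip (v s) := by
  refine linearMap_ext_word fun w => ?_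
  refine (hT.eq_on_lieProducts (Submodule.subset_span ⟨w.map v, ?_, rfl, rfl⟩) (v_mem_lieV s)).1
  intro x hx
  obtain ⟨s, _, rfl⟩ := List.mem_map.1 hx
  exact v_mem_lieV s

end IsAriTriangle

/-- The coproduct of a non-empty word, up to products of shorter non-empty words. -/
theorem co_word_sub_mem {w : List ℕ} (hw : w ≠ []) :
    co (word w) - (word w ⊗ₜ[ℚ] (1 : QV) + (1 : QV) ⊗ₜ[ℚ] word w) ∈
      Submodule.span ℚ {X | ∃ a b : List ℕ, a ≠ [] ∧ b ≠ [] ∧ a.length + b.length = w.length ∧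
        word a ⊗ₜ[ℚ] word b = X} := by
  induction w with
  | nil => exact absurd rfl hw
  | cons s w ih =>
    rcases eq_or_ne w [] with rfl | hw'
    · simp [word_singleton]
    have h := ih hw'
    set R := co (word w) - (word w ⊗ₜ[ℚ] (1 : QV) + (1 : QV) ⊗ₜ[ℚ] word w) with hR
    have hco : co (word w) = word w ⊗ₜ[ℚ] (1 : QV) + (1 : QV) ⊗ₜ[ℚ] word w + R := by
      rw [hR]; abel
    have key : co (word (s :: w)) - (word (s :: w) ⊗ₜ[ℚ] (1 : QV) + (1 : QV) ⊗ₜ[ℚ] word (s :: w)) =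
        word [s] ⊗ₜ[ℚ] word w + word w ⊗ₜ[ℚ] word [s] + co (v s) * R := by
      rw [word_cons, map_mul, hco, word_singleton, co_v]
      simp only [mul_add, add_mul, Algebra.TensorProduct.tmul_mul_tmul, mul_one, one_mul]
      abel
    rw [key]
    refine Submodule.add_mem _ (Submodule.add_mem _ (Submodule.subset_span ?_)
      (Submodule.subset_span ?_)) ?_
    · exact ⟨[s], w, by simp, hw', by simp [add_comm], rfl⟩
    · exact ⟨w, [s], hw', by simp, by simp, rfl⟩
    · clear_value R
      clear hR hco key ih
      induction h using Submodule.span_induction with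
      | mem X h =>
        obtain ⟨a, b, ha, hb, hab, rfl⟩ := h
        rw [co_v, add_mul, Algebra.TensorProduct.tmul_mul_tmul, Algebra.TensorProduct.tmul_mul_tmul,
          one_mul, one_mul, ← word_cons, ← word_cons]
        refine Submodule.add_mem _ (Submodule.subset_span ⟨_, _, by simp, hb, ?_, rfl⟩)
          (Submodule.subset_span ⟨_, _, ha, by simp, ?_, rfl⟩)
        · simp; omega
        · simp; omega
      | zero => simp
      | add X Y _ _ hX hY => rw [mul_add]; exact Submodule.add_mem _ hX hY
      | smul r X _ hX => rw [mul_smul_comm]; exact Submodule.smul_mem _ _ hX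

namespace IsAriTriangle

variable {T : QV →ₗ[ℚ] QV →ₗ[ℚ] QV}

/-- The linear map `A ↦ A ▷ 1` is idempotent for the convolution product, hence it is the counit. -/
theorem word_right_one (hT : IsAriTriangle T) {w : List ℕ} (hw : w ≠ []) : T (word w) 1 = 0 := by
  induction hn : w.length using Nat.strong_induction_on generalizing w with
  | _ n ih =>
    have h : ∀ X ∈ Submodule.span ℚ {X | ∃ a b : List ℕ, a ≠ [] ∧ b ≠ [] ∧
        a.length + b.length = w.length ∧ word a ⊗ₜ[ℚ] word b = X},
        LinearMap.mul' ℚ QV (TensorProduct.map (T.flip 1) (T.flip 1) X) = 0 := by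
      intro X hX
      induction hX using Submodule.span_induction with
      | mem X h =>
        obtain ⟨a, b, ha, hb, hab, rfl⟩ := h
        have hb' := List.length_pos_iff.2 hb
        have := ih a.length (by omega) ha rfl
        simp [this]
      | zero => simp
      | add X Y _ _ hX hY => rw [map_add, map_add, hX, hY, add_zero]
      | smul r X _ hX => rw [map_smul, map_smul, hX, smul_zero]
    have h1 := h _ (co_word_sub_mem hw)
    have h2 := hT.mul_right (word w) 1 1
    rw [mul_one, sweedlerMul] at h2
    rw [map_sub, map_sub, ← h2, map_add, map_add] at h1
    simp only [TensorProduct.map_tmul, LinearMap.mul'_apply, LinearMap.flip_apply, hT.one_left,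
      mul_one, one_mul] at h1
    simpa using h1

theorem eq_ariTriangle (hT : IsAriTriangle T) : T = ariTriangle := by
  have h1 : T.flip 1 = ariTriangle.flip 1 := by
    refine linearMap_ext_word fun w => ?_
    rcases eq_or_ne w [] with rfl | hw
    · simp only [LinearMap.flip_apply, word_nil, hT.one_left, ariTriangle_one_left]
    · rw [LinearMap.flip_apply, LinearMap.flip_apply, hT.word_right_one hw,
        isAriTriangle_ariTriangle.word_right_one hw]
  have h : T.flip = ariTriangle.flip := by
    ext1 B
    induction B using induction_right with
    | one => exact h1
    | add B C hB hC => rw [map_add, map_add, hB, hC]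
    | smul r B hB => rw [map_smul, map_smul, hB]
    | mul B k hB =>
      ext1 A
      rw [LinearMap.flip_apply, LinearMap.flip_apply, hT.mul_right, ariTriangle_mul, sweedlerMul,
        sweedlerMul, hB, hT.flip_v]
  rw [← T.flip_flip, h, LinearMap.flip_flip]

end IsAriTriangle

open WithConv

/-! ### The pairing and the shuffle product -/

theorem pairing_word (u w : List ℕ) : pairing (word u) (word w) = if u = w then 1 else 0 := by
  classical
  rw [← wordBasis_ofList, ← wordBasis_ofList, pairing, Module.Basis.constr_basis,
    Module.Basis.coord_apply, Module.Basis.repr_self, Finsupp.single_apply]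
  simp only [EmbeddingLike.apply_eq_iff_eq, eq_comm]

theorem pairing_ext {M : Type*} [AddCommMonoid M] [Module ℚ M] {f g : QV →ₗ[ℚ] QV →ₗ[ℚ] M}
    (h : ∀ u w, f (word u) (word w) = g (word u) (word w)) : f = g :=
  linearMap_ext_word fun u => linearMap_ext_word fun w => h u w

theorem pairing_one_one : pairing 1 1 = 1 := by simpa [word_nil] using pairing_word [] []

theorem pairing_one_right (A : QV) : pairing A 1 = counitHom A := by
  have : pairing.flip 1 = counitHom.toLinearMap := linearMap_ext_word fun w => by
    change pairing (word w) 1 = counitHom (word w)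
    rw [← word_nil, pairing_word]
    cases w <;> simp [word_nil, word_cons]
  exact LinearMap.congr_fun this A

theorem pairing_one_left (A : QV) : pairing 1 A = counitHom A := by
  have : pairing 1 = counitHom.toLinearMap := linearMap_ext_word fun w => by
    rw [← word_nil, pairing_word]
    cases w <;> simp [word_nil, word_cons]
  exact LinearMap.congr_fun this A

theorem pairing_v_mul (k x : ℕ) (A B : QV) :
    pairing (v k * A) (v x * B) = if k = x then pairing A B else 0 := by
  have : pairing.compl₁₂ (LinearMap.mulLeft ℚ (v k)) (LinearMap.mulLeft ℚ (v x)) =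
      (if k = x then (1 : ℚ) else 0) • pairing := pairing_ext fun u w => by
    simp only [LinearMap.compl₁₂_apply, LinearMap.mulLeft_apply, ← word_cons, pairing_word,
      LinearMap.smul_apply, List.cons.injEq]
    split_ifs <;> simp_all
  have h := LinearMap.congr_fun₂ this A B
  simp only [LinearMap.compl₁₂_apply, LinearMap.mulLeft_apply, LinearMap.smul_apply] at h
  rw [h]
  split_ifs <;> simp

theorem pairing_mul_v (k x : ℕ) (A B : QV) :
    pairing (A * v k) (B * v x) = if k = x then pairing A B else 0 := by
  have : pairing.compl₁₂ (LinearMap.mulRight ℚ (v k)) (LinearMap.mulRight ℚ (v x)) =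
      (if k = x then (1 : ℚ) else 0) • pairing := pairing_ext fun u w => by
    simp only [LinearMap.compl₁₂_apply, LinearMap.mulRight_apply, ← word_singleton, ← word_append,
      pairing_word, LinearMap.smul_apply, List.append_singleton_inj]
    split_ifs <;> simp_all
  have h := LinearMap.congr_fun₂ this A B
  simp only [LinearMap.compl₁₂_apply, LinearMap.mulRight_apply, LinearMap.smul_apply] at h
  rw [h]
  split_ifs <;> simp

/-- The functional `A ↦ (A ∣ C)`, as an element of the convolution algebra dual to `co`. -/
def dual : QV →ₗ[ℚ] WithConv (QV →ₗ[ℚ] ℚ) :=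
  (WithConv.linearEquiv ℚ _).symm.toLinearMap ∘ₗ pairing.flip

theorem dual_apply (C A : QV) : dual C A = pairing A C := rfl

theorem dual_one : dual 1 = 1 := by
  ext A
  exact pairing_one_right A

/-- Convolution products and left multiplication by a letter. -/
theorem conv_v_mul {R : Type*} [Ring R] [Algebra ℚ R] (f g : WithConv (QV →ₗ[ℚ] R)) (k : ℕ)
    (A : QV) : (f * g) (v k * A) = (toConv (f.ofConv ∘ₗ LinearMap.mulLeft ℚ (v k)) * g) A +
      (f * toConv (g.ofConv ∘ₗ LinearMap.mulLeft ℚ (v k))) A := by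
  simp only [LinearMap.convMul_apply, comul_eq_co, map_mul, co_v]
  generalize co A = X
  induction X with
  | zero => simp
  | add X Y hX hY => rw [mul_add, map_add, map_add, hX, hY]; simp only [map_add]; abel
  | tmul a b => simp [add_mul]

/-- Convolution products and right multiplication by a letter. -/
theorem conv_mul_v {R : Type*} [Ring R] [Algebra ℚ R] (f g : WithConv (QV →ₗ[ℚ] R)) (k : ℕ)
    (A : QV) : (f * g) (A * v k) = (toConv (f.ofConv ∘ₗ LinearMap.mulRight ℚ (v k)) * g) A +
      (f * toConv (g.ofConv ∘ₗ LinearMap.mulRight ℚ (v k))) A := by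
  simp only [LinearMap.convMul_apply, comul_eq_co, map_mul, co_v]
  generalize co A = X
  induction X with
  | zero => simp
  | add X Y hX hY => rw [add_mul, map_add, map_add, hX, hY]; simp only [map_add]; abel
  | tmul a b => simp [mul_add]

theorem conv_one {R : Type*} [Ring R] [Algebra ℚ R] (f g : WithConv (QV →ₗ[ℚ] R)) :
    (f * g) 1 = f 1 * g 1 := by
  rw [LinearMap.convMul_apply, comul_eq_co, map_one, Algebra.TensorProduct.one_def]
  rfl

theorem dual_v_mul_comp (k x : ℕ) (C : QV) :
    toConv ((dual (v x * C)).ofConv ∘ₗ LinearMap.mulLeft ℚ (v k)) =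
      if k = x then dual C else 0 := by
  ext A
  change pairing (v k * A) (v x * C) = _
  rw [pairing_v_mul]
  split_ifs <;> rfl

theorem dual_mul_v_comp (k x : ℕ) (C : QV) :
    toConv ((dual (C * v x)).ofConv ∘ₗ LinearMap.mulRight ℚ (v k)) =
      if k = x then dual C else 0 := by
  ext A
  change pairing (A * v k) (C * v x) = _
  rw [pairing_mul_v]
  split_ifs <;> rfl

theorem dual_one_comp_mulRight (k : ℕ) :
    toConv ((dual 1).ofConv ∘ₗ LinearMap.mulRight ℚ (v k)) = 0 := by
  ext A
  change pairing (A * v k) 1 = _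
  rw [pairing_one_right, map_mul, counitHom_v, mul_zero]
  rfl

theorem dual_shuffleWords (u w : List ℕ) :
    dual (shuffleWords u w) = dual (word u) * dual (word w) := by
  ext A
  induction A using induction_left generalizing u w with
  | one =>
    match u, w with
    | [], w => rw [shuffleWords, word_nil, dual_one, one_mul]
    | x :: u, [] => rw [shuffleWords, word_nil, dual_one, mul_one]
    | x :: u, y :: w =>
      rw [conv_one, shuffleWords]
      simp [dual_apply, word_cons, pairing_one_left]
  | add A B hA hB => rw [map_add, map_add, hA, hB]
  | smul r A hA => rw [map_smul, map_smul, hA]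
  | mul k A hA =>
    match u, w with
    | [], w => rw [shuffleWords, word_nil, dual_one, one_mul]
    | x :: u, [] => rw [shuffleWords, word_nil, dual_one, mul_one]
    | x :: u, y :: w =>
      rw [conv_v_mul, word_cons x, word_cons y, dual_v_mul_comp, dual_v_mul_comp, ← word_cons,
        ← word_cons, shuffleWords,
        dual_apply, map_add, pairing_v_mul, pairing_v_mul, ← dual_apply, ← dual_apply, hA, hA]
      split_ifs <;> simp

/-- The shuffle product is dual to the shuffle coproduct. -/
theorem dual_shuffle (X Y : QV) : dual (shuffle X Y) = dual X * dual Y := by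
  have h : shuffle.compr₂ dual =
      (LinearMap.mul ℚ (WithConv (QV →ₗ[ℚ] ℚ))).compl₁₂ dual dual := pairing_ext fun u w => by
    rw [LinearMap.compr₂_apply, LinearMap.compl₁₂_apply, LinearMap.mul_apply', ← dual_shuffleWords,
      shuffle]
    congr 1
    rw [← wordBasis_ofList, ← wordBasis_ofList, Module.Basis.constr_basis,
      Module.Basis.constr_basis]
    rfl
  exact LinearMap.congr_fun₂ h X Y

theorem antipode_one : antipode 1 = 1 := by simp [antipode]

theorem antipode_v_mul (k : ℕ) (A : QV) : antipode (v k * A) = -(antipode A * v k) := by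
  simp [antipode, v]

theorem tmul_pairing (A B C D : QV) :
    (pairing.tmul pairing) (A ⊗ₜ[ℚ] B) (C ⊗ₜ[ℚ] D) = pairing A C * pairing B D := by
  simp [mul_comm]

/-- The pairing on `ℚ⟨V⟩ ⊗ ℚ⟨V⟩` is nondegenerate. -/
theorem eq_of_tmul_pairing_eq {X Y : QV ⊗[ℚ] QV}
    (h : ∀ A B, (pairing.tmul pairing) (A ⊗ₜ[ℚ] B) X = (pairing.tmul pairing) (A ⊗ₜ[ℚ] B) Y) :
    X = Y := by
  have key (u w : FreeMonoid ℕ) (X : QV ⊗[ℚ] QV) :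
      (pairing.tmul pairing) (wordBasis u ⊗ₜ[ℚ] wordBasis w) X =
        (wordBasis.tensorProduct wordBasis).repr X (u, w) := by
    induction X with
    | zero => simp
    | add X Y hX hY => rw [map_add, hX, hY, map_add, Finsupp.add_apply]
    | tmul a b =>
      rw [tmul_pairing, pairing, Module.Basis.constr_basis, Module.Basis.constr_basis]
      simp [mul_comm]
  refine (wordBasis.tensorProduct wordBasis).ext_elem fun uw => ?_
  rw [← key, ← key, h]

/-! ### Subwords -/

section subword

variable {d : ℕ}

theorem filter_range_eq {a b : ℕ} (h : b ≤ d) :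
    (List.range d).filter (fun p => a ≤ p ∧ p < b) = List.range' a (b - a) := by
  refine List.Perm.eq_of_pairwise (le := (· < ·))
    (fun a b _ _ h h' => absurd h (lt_asymm h')) ?_ ?_ ?_
  · exact List.Pairwise.filter _ List.pairwise_lt_range
  · exact List.pairwise_lt_range'
  · refine (List.perm_ext_iff_of_nodup (List.nodup_range.filter _) List.nodup_range').2 fun p => ?_
    simp only [List.mem_filter, List.mem_range, List.mem_range'_1, decide_eq_true_eq]
    omega

/-- A function on positions, extended by `0`. -/
def extend (f : Fin d → ℕ) (p : ℕ) : ℕ := if h : p < d then f ⟨p, h⟩ else 0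

theorem subword_eq (f : Fin d → ℕ) {a b : ℕ} (h : b ≤ d) :
    subword f a b = word ((List.range' a (b - a)).map (extend f)) := by
  rw [subword, ← filter_range_eq h, ← List.map_coe_finRange_eq_range, List.filter_map, List.map_map]
  congr 2
  funext p
  simp [extend]

theorem subword_of_le (f : Fin d → ℕ) {a b : ℕ} (h : b ≤ d) (h' : b ≤ a) : subword f a b = 1 := by
  rw [subword_eq f h, Nat.sub_eq_zero_of_le h']
  rfl

theorem subword_succ_right (f : Fin d → ℕ) {a b : ℕ} (h : b < d) (h' : a ≤ b) :
    subword f a (b + 1) = subword f a b * v (f ⟨b, h⟩) := by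
  rw [subword_eq f (by omega), subword_eq f (by omega), Nat.sub_add_comm h', List.range'_concat,
    List.map_append, word_append, List.map_singleton, word_singleton, one_mul,
    show a + (b - a) = b by omega, extend, dif_pos h]

theorem subword_succ_left (f : Fin d → ℕ) {a b : ℕ} (h : b ≤ d) (h' : a < b) :
    subword f a b = v (f ⟨a, by omega⟩) * subword f (a + 1) b := by
  rw [subword_eq f h, subword_eq f h, show b - a = (b - (a + 1)) + 1 by omega, List.range'_succ,
    List.map_cons, word_cons, extend, dif_pos (show a < d by omega)]

theorem subword_congr {f g : Fin d → ℕ} {a b : ℕ}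
    (h : ∀ p : Fin d, a ≤ p → (p : ℕ) < b → f p = g p) :
    subword f a b = subword g a b := by
  rw [subword, subword]
  congr 1
  refine List.map_congr_left fun p hp => ?_
  simp only [List.mem_filter, decide_eq_true_eq] at hp
  exact h p hp.2.1 hp.2.2

theorem subword_full (f : Fin d → ℕ) : subword f 0 d = word (List.ofFn f) := by
  rw [subword, List.filter_eq_self.2 (by simp), List.ofFn_eq_map]

/-- Deconcatenation is dual to concatenation. -/
theorem pairing_mul_subword (f : Fin d → ℕ) (A B : QV) {a b : ℕ} (h : b ≤ d) (h' : a ≤ b) :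
    pairing (A * B) (subword f a b) =
      ∑ m ∈ Finset.Icc a b, pairing A (subword f a m) * pairing B (subword f m b) := by
  induction B using induction_right generalizing b with
  | one =>
    rw [Finset.sum_eq_single b]
    · rw [mul_one, subword_of_le f h le_rfl, pairing_one_one, mul_one]
    · intro m hm hne
      rw [Finset.mem_Icc] at hm
      rw [subword_succ_left f h (by omega), pairing_one_left, map_mul, counitHom_v, zero_mul,
        mul_zero]
    · intro hn
      exact absurd (Finset.mem_Icc.2 ⟨h', le_rfl⟩) hn
  | add B C hB hC =>
    simp only [mul_add, map_add, LinearMap.add_apply, hB h h', hC h h', Finset.sum_add_distrib]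
  | smul r B hB =>
    simp only [mul_smul_comm, map_smul, LinearMap.smul_apply, hB h h', Finset.smul_sum]
  | mul B k hB =>
    rcases h'.eq_or_lt with rfl | h''
    · rw [Finset.Icc_self, Finset.sum_singleton, subword_of_le f h le_rfl]
      simp [pairing_one_right]
    · obtain ⟨b, rfl⟩ := Nat.exists_eq_add_one_of_ne_zero (show b ≠ 0 by omega)
      have hb : b < d := h
      rw [← mul_assoc, subword_succ_right f hb (by omega), pairing_mul_v,
        Finset.sum_Icc_succ_top (by omega), subword_of_le f (a := b + 1) h le_rfl,
        pairing_one_right (B * v k), map_mul counitHom, counitHom_v, mul_zero, mul_zero, add_zero]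
      have : ∀ m ∈ Finset.Icc a b, pairing A (subword f a m) *
          pairing (B * v k) (subword f m (b + 1)) =
          if k = f ⟨b, hb⟩ then pairing A (subword f a m) * pairing B (subword f m b) else 0 := by
        intro m hm
        rw [subword_succ_right f hb (Finset.mem_Icc.1 hm).2, pairing_mul_v, mul_ite, mul_zero]
      rw [Finset.sum_congr rfl this]
      split_ifs
      · exact hB (by omega) (by omega)
      · simp

end subword

/-! ### The dual of the action on letters -/

section letter

variable {d : ℕ}

/-- The multiplicity `m_{k+l,k}`. -/
def weight (k l : Fin d → ℕ) : ℚ := ∏ p, coef (k p + l p) (k p)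

/-- The positions `a ≤ p < b` other than `q`. -/
def blockPos (a : ℕ) (q : Fin d) (b : ℕ) : Finset (Fin d) :=
  Finset.univ.filter fun p => a ≤ p ∧ (p : ℕ) < b ∧ p ≠ q

theorem mem_blockPos {a b : ℕ} {q p : Fin d} :
    p ∈ blockPos a q b ↔ a ≤ p ∧ (p : ℕ) < b ∧ p ≠ q := by
  simp [blockPos]

/-- The functional dual to the part of `[a, b)` before `q` (with antipode) and the part after `q`,
with indices shifted by `l`. -/
def sides (k l : Fin d → ℕ) (a : ℕ) (q : Fin d) (b : ℕ) : WithConv (QV →ₗ[ℚ] ℚ) :=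
  dual (antipode (subword (k + l) a q)) * dual (subword (k + l) (q + 1) b)

theorem weight_update (k l : Fin d → ℕ) {q : Fin d} (hq : l q = 0) (r : ℕ) :
    weight k (Function.update l q r) = coef (k q + r) (k q) * weight k l := by
  rw [weight, weight, ← Finset.mul_prod_erase _ _ (Finset.mem_univ q),
    ← Finset.mul_prod_erase _ (fun p => coef (k p + l p) (k p)) (Finset.mem_univ q), hq,
    Function.update_self, add_zero, coef_self, one_mul]
  congr 1
  refine Finset.prod_congr rfl fun p hp => ?_
  rw [Function.update_of_ne (Finset.ne_of_mem_erase hp)]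

/-- Fixing the entry at one position in a sum over shifts of given size. -/
theorem sum_piAntidiag_insert_ite (k : Fin d → ℕ) {q : Fin d} {β : Finset (Fin d)} (hq : q ∉ β)
    (N c : ℕ) (H : (Fin d → ℕ) → ℚ) (hH : ∀ l r, H (Function.update l q r) = H l) :
    ∑ l ∈ Finset.piAntidiag (insert q β) N, weight k l * (if c = k q + l q then H l else 0) =
      if k q ≤ c ∧ c - k q ≤ N then
        coef c (k q) * ∑ l ∈ Finset.piAntidiag β (N - (c - k q)), weight k l * H l
      else 0 := by
  simp only [mul_ite, mul_zero]
  rw [← Finset.sum_filter]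
  split_ifs with h
  · rw [Finset.mul_sum]
    have hupd (l : Fin d → ℕ) (r : ℕ) : ∑ p ∈ β, Function.update l q r p = ∑ p ∈ β, l p :=
      Finset.sum_congr rfl fun p hp => Function.update_of_ne (fun e : p = q => hq (e ▸ hp)) _ _
    refine Finset.sum_nbij' (fun l => Function.update l q 0)
      (fun l => Function.update l q (c - k q)) ?_ ?_ ?_ ?_ ?_
    · intro l hl
      simp only [Finset.mem_filter, Finset.mem_piAntidiag, Finset.sum_insert hq] at hl ⊢
      refine ⟨by rw [hupd]; omega, fun p hp => ?_⟩
      rcases eq_or_ne p q with rfl | hne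
      · simp at hp
      · rw [Function.update_of_ne hne] at hp
        exact Finset.mem_of_mem_insert_of_ne (hl.1.2 p hp) hne
    · intro l hl
      simp only [Finset.mem_filter, Finset.mem_piAntidiag, Finset.sum_insert hq] at hl ⊢
      refine ⟨⟨by rw [hupd, Function.update_self, hl.1]; omega, fun p hp => ?_⟩, ?_⟩
      · rcases eq_or_ne p q with rfl | hne
        · simp
        · rw [Function.update_of_ne hne] at hp
          exact Finset.mem_insert_of_mem (hl.2 p hp)
      · rw [Function.update_self]
        omega
    · intro l hl
      simp only [Finset.mem_filter] at hl
      rw [Function.update_idem, show c - k q = l q by omega, Function.update_eq_self]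
    · intro l hl
      rw [Finset.mem_piAntidiag] at hl
      have : l q = 0 := by_contra fun h => hq (hl.2 q h)
      rw [Function.update_idem, ← this, Function.update_eq_self]
    · intro l hl
      simp only [Finset.mem_filter] at hl
      have h1 := weight_update k (Function.update l q 0) (Function.update_self q 0 l) (l q)
      rw [Function.update_idem, Function.update_eq_self, ← hl.2] at h1
      rw [hH, h1, mul_assoc]
  · refine Finset.sum_eq_zero fun l hl => absurd ?_ h
    simp only [Finset.mem_filter, Finset.mem_piAntidiag, Finset.sum_insert hq] at hl
    omega

theorem sides_update_of_lt (k l : Fin d → ℕ) {a b : ℕ} {q p : Fin d}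
    (hp : (p : ℕ) < a) (haq : a ≤ q) (r : ℕ) :
    sides k (Function.update l p r) a q b = sides k l a q b := by
  have h {x : Fin d} (hx : x ≠ p) : (k + Function.update l p r) x = (k + l) x := by
    rw [Pi.add_apply, Pi.add_apply, Function.update_of_ne hx]
  rw [sides, sides, subword_congr (b := q) fun x hx _ => h (by rintro rfl; omega),
    subword_congr (a := q + 1) fun x hx _ => h (by rintro rfl; omega)]

theorem sides_update_of_ge (k l : Fin d → ℕ) {a b : ℕ} {q p : Fin d}
    (hp : b ≤ (p : ℕ)) (hqb : q < b) (r : ℕ) :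
    sides k (Function.update l p r) a q b = sides k l a q b := by
  have h {x : Fin d} (hx : x ≠ p) : (k + Function.update l p r) x = (k + l) x := by
    rw [Pi.add_apply, Pi.add_apply, Function.update_of_ne hx]
  rw [sides, sides, subword_congr (b := q) fun x _ hx => h (by rintro rfl; omega),
    subword_congr (a := q + 1) fun x _ hx => h (by rintro rfl; omega)]

theorem sides_mul_v (k l : Fin d → ℕ) {a b : ℕ} {q : Fin d} (ha : a ≤ q) (hqb : (q : ℕ) ≤ b)
    (hb : b < d) (A : QV) (c : ℕ) :
    sides k l a q (b + 1) (A * v c) =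
      (if (q : ℕ) < b then if c = k ⟨b, hb⟩ + l ⟨b, hb⟩ then sides k l a q b A else 0 else 0) -
      (if a < q then if c = k ⟨a, by omega⟩ + l ⟨a, by omega⟩ then
        sides k l (a + 1) q (b + 1) A else 0 else 0) := by
  rw [sides, conv_mul_v, add_comm, sub_eq_add_neg]
  congr 1
  · split_ifs with h1 h2
    · rw [subword_succ_right _ hb h1, dual_mul_v_comp, if_pos (by exact h2)]
      rfl
    · rw [subword_succ_right _ hb h1, dual_mul_v_comp, if_neg (by exact h2), mul_zero]
      rfl
    · rw [subword_of_le _ hb (by omega), dual_one_comp_mulRight, mul_zero]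
      rfl
  · split_ifs with h1 h2
    · rw [subword_succ_left _ q.2.le h1, antipode_v_mul, ← neg_mul, dual_mul_v_comp,
        if_pos (by exact h2), map_neg]
      exact congrArg (fun f => f.ofConv A) (neg_mul (dual _) (dual _))
    · rw [subword_succ_left _ q.2.le h1, antipode_v_mul, ← neg_mul, dual_mul_v_comp,
        if_neg (by exact h2), zero_mul, neg_zero]
      rfl
    · rw [subword_of_le _ q.2.le (by omega), antipode_one, dual_one_comp_mulRight, zero_mul,
        neg_zero]
      rfl

/-- The value on `A` of the functional dual to the action on `v_s`, evaluated on the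
subword `[a, b)`. -/
def letterSum (k : Fin d → ℕ) (s a b : ℕ) (A : QV) : ℚ :=
  ∑ q : Fin d, if a ≤ q ∧ (q : ℕ) < b ∧ s ≤ k q then
    ∑ l ∈ Finset.piAntidiag (blockPos a q b) (k q - s), weight k l * sides k l a q b A else 0

/-- Removing the last letter `v_c` of `A` removes the last or the first letter of the subword: a
letter of the part before `q`, reversed by the antipode, is matched in opposite order. -/
theorem letterSum_mul_v (k : Fin d → ℕ) (s : ℕ) {a b : ℕ} (hab : a ≤ b) (hb : b < d) (A : QV)
    (c : ℕ) :
    letterSum k s a (b + 1) (A * v c) =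
      (if k ⟨b, hb⟩ ≤ c then
        coef c (k ⟨b, hb⟩) * letterSum k (s + (c - k ⟨b, hb⟩)) a b A else 0) -
      (if k ⟨a, by omega⟩ ≤ c then
        coef c (k ⟨a, by omega⟩) * letterSum k (s + (c - k ⟨a, by omega⟩)) (a + 1) (b + 1) A
        else 0) := by
  have hite (P : Prop) [Decidable P] (x : ℚ) (f : Fin d → ℚ) :
      (if P then x * ∑ q, f q else 0) = ∑ q, if P then x * f q else 0 := by
    split_ifs <;> simp [Finset.mul_sum]
  simp only [letterSum]
  rw [hite, hite, ← Finset.sum_sub_distrib]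
  refine Finset.sum_congr rfl fun q _ => ?_
  by_cases hq : a ≤ q ∧ (q : ℕ) < b + 1 ∧ s ≤ k q
  swap
  · rw [if_neg hq, if_neg (c := a ≤ q ∧ _) (by omega), if_neg (c := a + 1 ≤ q ∧ _) (by omega)]
    simp
  rw [if_pos hq]
  simp only [sides_mul_v k _ hq.1 (Nat.le_of_lt_succ hq.2.1) hb, mul_sub, Finset.sum_sub_distrib]
  congr 1
  · by_cases hqb : (q : ℕ) < b
    · have hins : blockPos a q (b + 1) = insert ⟨b, hb⟩ (blockPos a q b) := by
        ext p
        simp only [Finset.mem_insert, mem_blockPos, Fin.ext_iff]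
        omega
      simp only [if_pos hqb]
      rw [hins, sum_piAntidiag_insert_ite k (by simp [mem_blockPos]) _ _
        (fun l => sides k l a q b A)
        (fun l r => by rw [sides_update_of_ge k l le_rfl hqb])]
      by_cases h1 : k ⟨b, hb⟩ ≤ c
      · rw [if_pos h1]
        by_cases h2 : c - k ⟨b, hb⟩ ≤ k q - s
        · rw [if_pos ⟨h1, h2⟩, if_pos (by omega), Nat.sub_sub]
        · rw [if_neg (by omega), if_neg (by omega), mul_zero]
      · rw [if_neg (by omega), if_neg h1]
    · simp [hqb]
  · by_cases hqa : a < q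
    · have hins : blockPos a q (b + 1) = insert ⟨a, by omega⟩ (blockPos (a + 1) q (b + 1)) := by
        ext p
        simp only [Finset.mem_insert, mem_blockPos, Fin.ext_iff]
        omega
      simp only [if_pos hqa]
      rw [hins, sum_piAntidiag_insert_ite k (by simp [mem_blockPos]) _ _
        (fun l => sides k l (a + 1) q (b + 1) A)
        (fun l r => by rw [sides_update_of_lt k l (Nat.lt_succ_self a) hqa])]
      by_cases h1 : k ⟨a, by omega⟩ ≤ c
      · rw [if_pos h1]
        by_cases h2 : c - k ⟨a, by omega⟩ ≤ k q - s
        · rw [if_pos ⟨h1, h2⟩, if_pos (by omega), Nat.sub_sub]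
        · rw [if_neg (by omega), if_neg (by omega), mul_zero]
      · rw [if_neg (by omega), if_neg h1]
    · have : ¬ a + 1 ≤ (q : ℕ) := by omega
      simp [hqa, this]

theorem sides_apply_one (k l : Fin d → ℕ) {a b : ℕ} {q : Fin d} (haq : a ≤ q) (hqb : q < b)
    (hb : b ≤ d) : sides k l a q b 1 = if a = q ∧ q + 1 = b then 1 else 0 := by
  rw [sides, conv_one, dual_apply, dual_apply, pairing_one_left, pairing_one_left]
  split_ifs with h
  · rw [subword_of_le _ q.2.le (by omega), subword_of_le _ hb (by omega), antipode_one, map_one,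
      mul_one]
  · by_cases h1 : a = q
    · rw [subword_succ_left _ hb (show (q : ℕ) + 1 < b by omega), map_mul, counitHom_v]
      simp
    · rw [subword_succ_left _ q.2.le (show a < (q : ℕ) by omega), antipode_v_mul, map_neg, map_mul,
        counitHom_v]
      simp

theorem blockPos_eq_empty_iff {a b : ℕ} {q : Fin d} (haq : a ≤ q) (hqb : q < b) (hb : b ≤ d) :
    blockPos a q b = ∅ ↔ a = q ∧ q + 1 = b := by
  constructor
  · intro h
    by_contra hne
    by_cases h1 : a = q
    · have hm : (⟨q + 1, by omega⟩ : Fin d) ∈ blockPos a q b := by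
        simp only [mem_blockPos, ne_eq, Fin.ext_iff]
        omega
      simp [h] at hm
    · have hm : (⟨a, by omega⟩ : Fin d) ∈ blockPos a q b := by
        simp only [mem_blockPos, ne_eq, Fin.ext_iff]
        omega
      simp [h] at hm
  · intro h
    refine Finset.eq_empty_of_forall_notMem fun p hp => ?_
    simp only [mem_blockPos, ne_eq, Fin.ext_iff] at hp
    omega

theorem letterSum_one (k : Fin d → ℕ) (s : ℕ) {a b : ℕ} (hab : a ≤ b) (hb : b ≤ d) :
    letterSum k s a b 1 = pairing (v s) (subword k a b) := by
  rw [letterSum]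
  by_cases hab' : b = a + 1
  · subst hab'
    rw [Finset.sum_eq_single ⟨a, hb⟩]
    · have hblock : blockPos a (⟨a, hb⟩ : Fin d) (a + 1) = ∅ :=
        (blockPos_eq_empty_iff (q := ⟨a, hb⟩) le_rfl (Nat.lt_succ_self a) hb).2 ⟨rfl, rfl⟩
      rw [subword_succ_right k hb le_rfl, subword_of_le k (by omega) le_rfl, ← one_mul (v s),
        pairing_mul_v, pairing_one_one, hblock, Finset.piAntidiag_empty]
      by_cases h : s ≤ k ⟨a, hb⟩
      · rw [if_pos ⟨le_rfl, Nat.lt_succ_self a, h⟩]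
        by_cases h' : s = k ⟨a, hb⟩
        · rw [if_pos (by omega), if_pos h', Finset.sum_singleton,
            sides_apply_one k (q := ⟨a, hb⟩) _ le_rfl (Nat.lt_succ_self a) hb, if_pos ⟨rfl, rfl⟩]
          simp [weight, coef_self]
        · rw [if_neg (by omega), if_neg h', Finset.sum_empty]
      · rw [if_neg (by omega), if_neg (by omega)]
    · intro q _ hne
      refine if_neg fun h => hne (Fin.ext ?_)
      change (q : ℕ) = a
      omega
    · simp
  · rw [Finset.sum_eq_zero]
    · rcases hab.eq_or_lt with rfl | h
      · rw [subword_of_le k hb le_rfl, pairing_one_right, counitHom_v]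
      · rw [subword_succ_left k hb h, subword_succ_left k hb (by omega), ← mul_one (v s),
          pairing_v_mul, pairing_one_left, map_mul, counitHom_v]
        simp
    · intro q _
      split_ifs with h
      · refine Finset.sum_eq_zero fun l _ => ?_
        rw [sides_apply_one k l h.1 h.2.1 hb, if_neg (by omega), mul_zero]
      · rfl

/-- The functional dual to the action on a letter `v_s` with `s ≥ 1`. -/
theorem pairing_act_subword_of_ne_zero (k : Fin d → ℕ) {s : ℕ} (hs : s ≠ 0) {a b : ℕ}
    (hab : a ≤ b) (hb : b ≤ d) (A : QV) :
    pairing (act A v s) (subword k a b) = letterSum k s a b A := by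
  induction A using induction_right generalizing s a b with
  | one => rw [letterSum_one k s hab hb, act_one]; rfl
  | add A B hA hB =>
    rw [act_add, LinearMap.add_apply, Pi.add_apply, map_add, LinearMap.add_apply, hA hs hab hb,
      hB hs hab hb]
    rw [letterSum, letterSum, ← Finset.sum_add_distrib]
    refine Finset.sum_congr rfl fun q _ => ?_
    split_ifs
    · simp only [map_add, mul_add, Finset.sum_add_distrib]
    · rw [add_zero]
  | smul r A hA =>
    rw [act_smul, LinearMap.smul_apply, Pi.smul_apply, map_smul, LinearMap.smul_apply, hA hs hab hb]
    simp only [letterSum, map_smul, smul_eq_mul, mul_left_comm _ r, ← Finset.mul_sum]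
    rw [Finset.mul_sum]
    simp only [mul_ite_zero]
  | mul A c hA =>
    have hact : act (A * v c) v s = ∑ l ∈ Finset.Iic c, coef c l •
        (act A v (s + (c - l)) * v l - v l * act A v (s + (c - l))) := by
      rw [act_mul, act_v, letterOp_apply, if_neg hs, shiftHom_v, map_sum]
      refine Finset.sum_congr rfl fun l _ => ?_
      rw [bracketEval_monomial, mul_smul_comm, smul_mul_assoc, smul_sub]
    rw [hact]
    rcases hab.eq_or_lt with rfl | hlt
    · rw [subword_of_le k hb le_rfl, pairing_one_right, map_sum, letterSum, Finset.sum_eq_zero,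
        Finset.sum_eq_zero]
      · intro q _
        exact if_neg (by omega)
      · intro l _
        rw [map_smul, map_sub, map_mul, map_mul, mul_comm, sub_self, smul_zero]
    · obtain ⟨b, rfl⟩ := Nat.exists_eq_add_one_of_ne_zero (show b ≠ 0 by omega)
      have hb' : b < d := hb
      rw [letterSum_mul_v k s (by omega) hb']
      have hterm (l : ℕ) : pairing (coef c l •
          (act A v (s + (c - l)) * v l - v l * act A v (s + (c - l)))) (subword k a (b + 1)) =
          (if l = k ⟨b, hb'⟩ then coef c l * letterSum k (s + (c - l)) a b A else 0) -
          (if l = k ⟨a, by omega⟩ then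
            coef c l * letterSum k (s + (c - l)) (a + 1) (b + 1) A else 0) := by
        rw [map_smul, map_sub, LinearMap.smul_apply, LinearMap.sub_apply, smul_eq_mul, mul_sub]
        congr 1
        · rw [subword_succ_right k hb' (by omega), pairing_mul_v, mul_ite, mul_zero,
            hA (by omega) (by omega) (by omega)]
        · rw [subword_succ_left k hb hlt, pairing_v_mul, mul_ite, mul_zero,
            hA (by omega) (by omega) (by omega)]
      rw [map_sum, LinearMap.sum_apply]
      simp only [hterm, Finset.sum_sub_distrib, Finset.sum_ite_eq', Finset.mem_Iic]

theorem act_zero_index (A : QV) : act A v 0 = counitHom A • v 0 := by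
  induction A using induction_right with
  | one => simp [act_one]
  | add A B hA hB => simp [act_add, hA, hB, add_smul]
  | smul r A hA => simp [act_smul, hA, mul_smul]
  | mul A k hA => rw [act_mul, act_v, letterOp_apply, map_mul, counitHom_v]; simp

/-- The shifts `l` supported on `β` with `β = ∅` or `|l| < k q`. -/
def blockShifts (k : Fin d → ℕ) (β : Finset (Fin d)) (q : Fin d) : Finset (Fin d → ℕ) :=
  (Finset.Iic fun _ => ∑ p, k p).filter fun l =>
    (∀ p, p ∉ β → l p = 0) ∧ (β = ∅ ∨ ∑ p ∈ β, l p < k q)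

theorem filter_blockShifts (k : Fin d → ℕ) (β : Finset (Fin d)) (q : Fin d) {s : ℕ} (hs : s ≠ 0) :
    (blockShifts k β q).filter (fun l => s = k q - ∑ p ∈ β, l p) =
      if s ≤ k q then Finset.piAntidiag β (k q - s) else ∅ := by
  ext l
  split_ifs with h
  · simp only [blockShifts, Finset.mem_filter, Finset.mem_Iic, Finset.mem_piAntidiag, Pi.le_def]
    have hsum : β.sum l = ∑ p ∈ β, l p := rfl
    constructor
    · rintro ⟨⟨_, h1, _⟩, h3⟩
      exact ⟨by omega, fun p hp => by_contra fun hn => hp (h1 p hn)⟩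
    · rintro ⟨h1, h2⟩
      have h3 : ∀ p, p ∉ β → l p = 0 := fun p hp => by_contra fun hn => hp (h2 p hn)
      refine ⟨⟨fun p => ?_, h3, Or.inr (by omega)⟩, by omega⟩
      by_cases hp : p ∈ β
      · have h4 : l p ≤ ∑ p ∈ β, l p := Finset.single_le_sum (fun _ _ => Nat.zero_le _) hp
        have h5 : k q ≤ ∑ p, k p :=
          Finset.single_le_sum (fun _ _ => Nat.zero_le _) (Finset.mem_univ q)
        omega
      · simp [h3 p hp]
  · simp only [Finset.mem_filter, Finset.notMem_empty, iff_false]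
    omega

/-- The functional dual to the action on a letter. -/
theorem pairing_act_subword (k : Fin d → ℕ) (s : ℕ) {a b : ℕ} (hab : a ≤ b) (hb : b ≤ d)
    (A : QV) : pairing (act A v s) (subword k a b) =
      ∑ q : Fin d, if a ≤ q ∧ (q : ℕ) < b then
        ∑ l ∈ blockShifts k (blockPos a q b) q,
          (weight k l * if s = k q - ∑ p ∈ blockPos a q b, l p then 1 else 0) * sides k l a q b A
      else 0 := by
  simp only [mul_ite, mul_one, mul_zero, ite_mul, zero_mul]
  simp only [← Finset.sum_filter (s := blockShifts k _ _)]
  rcases eq_or_ne s 0 with rfl | hs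
  -- `v_0` is fixed up to the counit. Accordingly `k q = |l|` is only possible for an empty block
  -- and `k q = 0`; all other shifts satisfy `|l| < k q`.
  · rw [act_zero_index, map_smul, LinearMap.smul_apply, ← letterSum_one k 0 hab hb, letterSum,
      Finset.smul_sum]
    refine Finset.sum_congr rfl fun q _ => ?_
    by_cases hq : a ≤ q ∧ (q : ℕ) < b
    swap
    · rw [if_neg hq, if_neg (by omega), smul_zero]
    rw [if_pos hq, if_pos ⟨hq.1, hq.2, Nat.zero_le _⟩]
    simp only [sides_apply_one k _ hq.1 hq.2 hb]
    by_cases hβ : a = q ∧ (q : ℕ) + 1 = b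
    · have hβ' := (blockPos_eq_empty_iff hq.1 hq.2 hb).2 hβ
      have hfilter : (blockShifts k ∅ q).filter (fun l => 0 = k q - ∑ p ∈ ∅, l p) =
          if k q = 0 then {0} else ∅ := by
        ext l
        split_ifs with h
        · simp only [blockShifts, Finset.mem_filter, Finset.mem_Iic, Finset.mem_singleton, h]
          constructor
          · rintro ⟨⟨_, h1, _⟩, _⟩
            funext p
            exact h1 p (Finset.notMem_empty p)
          · rintro rfl
            simp
        · refine iff_of_false (fun hl => ?_) (Finset.notMem_empty _)
          have := (Finset.mem_filter.1 hl).2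
          rw [Finset.sum_empty] at this
          omega
      rw [hβ', hfilter, Finset.piAntidiag_empty, Nat.sub_zero]
      split_ifs with h
      · rw [Finset.sum_singleton, Finset.sum_singleton, sides, subword_of_le _ q.2.le (by omega),
          subword_of_le _ hb (by omega), antipode_one, dual_one, mul_one, mul_one, smul_eq_mul,
          mul_comm]
        rfl
      · simp
    · rw [if_neg hβ]
      have hβ' : blockPos a q b ≠ ∅ := fun h => hβ ((blockPos_eq_empty_iff hq.1 hq.2 hb).1 h)
      have hfilter : (blockShifts k (blockPos a q b) q).filter
          (fun l => 0 = k q - ∑ p ∈ blockPos a q b, l p) = ∅ := by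
        refine Finset.filter_eq_empty_iff.2 fun l hl h => ?_
        have := (Finset.mem_filter.1 hl).2.2.resolve_left hβ'
        omega
      rw [hfilter]
      simp
  · rw [pairing_act_subword_of_ne_zero k hs hab hb, letterSum]
    refine Finset.sum_congr rfl fun q _ => ?_
    rw [filter_blockShifts k _ q hs]
    split_ifs with h1 h2 h3 h4
    · rfl
    · omega
    · omega
    · omega
    · rfl
    · rfl

end letter

/-! ### Removing the last cut -/

section cuts

variable {d n : ℕ}

/-- The pairs `(i, j)` as in `cuts`, but with last cut at `e`. -/
def cutsTo (d n e : ℕ) : Finset ((Fin (n + 1) → Fin (d + 1)) × (Fin n → Fin d)) :=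
  Finset.univ.filter fun ij =>
    (ij.1 (Fin.last n) : ℕ) = e ∧
      ∀ s : Fin n, (ij.1 s.castSucc : ℕ) ≤ ij.2 s ∧ (ij.2 s : ℕ) < ij.1 s.succ

theorem mem_cutsTo {e : ℕ} {i : Fin (n + 1) → Fin (d + 1)} {j : Fin n → Fin d} :
    (i, j) ∈ cutsTo d n e ↔ (i (Fin.last n) : ℕ) = e ∧
      ∀ s : Fin n, (i s.castSucc : ℕ) ≤ j s ∧ (j s : ℕ) < i s.succ := by
  simp [cutsTo]

theorem strictMono_of_mem_cutsTo {e : ℕ} {i : Fin (n + 1) → Fin (d + 1)} {j : Fin n → Fin d}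
    (h : (i, j) ∈ cutsTo d n e) : StrictMono i :=
  Fin.strictMono_iff_lt_succ.2 fun s => by
    have := (mem_cutsTo.1 h).2 s
    rw [Fin.lt_def]
    omega

theorem cut_succ_le {e : ℕ} {i : Fin (n + 1) → Fin (d + 1)} {j : Fin n → Fin d}
    (h : (i, j) ∈ cutsTo d n e) (s : Fin n) : (i s.succ : ℕ) ≤ e := by
  rw [← (mem_cutsTo.1 h).1]
  exact (strictMono_of_mem_cutsTo h).monotone (Fin.le_last _)

theorem cutsTo_eq_empty {e : ℕ} (h : d < n) : cutsTo d n e = ∅ := by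
  refine Finset.eq_empty_of_forall_notMem fun ij hij => ?_
  have := Fintype.card_le_of_injective _
    (strictMono_of_mem_cutsTo (i := ij.1) (j := ij.2) hij).injective
  simp at this
  omega

/-- Appending an entry to a tuple. -/
abbrev snoc {α : Type*} (f : Fin n → α) (x : α) : Fin (n + 1) → α := Fin.snoc (α := fun _ => α) f x

theorem snoc_mem_cutsTo {m e : Fin (d + 1)} {q : Fin d} {i : Fin (n + 1) → Fin (d + 1)}
    {j : Fin n → Fin d} :
    (snoc i e, snoc j q) ∈ cutsTo d (n + 1) e ∧ i (Fin.last n) = m ↔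
      (m ≤ (q : ℕ) ∧ (q : ℕ) < e) ∧ (i, j) ∈ cutsTo d n m := by
  simp only [mem_cutsTo, Fin.forall_fin_succ', Fin.snoc_castSucc, Fin.snoc_last, Fin.succ_last,
    ← Fin.castSucc_succ, true_and, Fin.ext_iff]
  constructor
  · rintro ⟨⟨h1, h2⟩, h3⟩
    exact ⟨⟨h3 ▸ h2.1, h2.2⟩, h3, h1⟩
  · rintro ⟨h2, h3, h1⟩
    exact ⟨⟨h1, h3 ▸ h2.1, h2.2⟩, h3⟩

theorem sum_cutsTo_succ {M : Type*} [AddCommMonoid M] (e : Fin (d + 1))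
    (f : (Fin (n + 2) → Fin (d + 1)) × (Fin (n + 1) → Fin d) → M) :
    ∑ ij ∈ cutsTo d (n + 1) e, f ij = ∑ m : Fin (d + 1), ∑ q : Fin d,
      if (m : ℕ) ≤ q ∧ (q : ℕ) < e then
        ∑ ij ∈ cutsTo d n m, f (snoc ij.1 e, snoc ij.2 q)
      else 0 := by
  rw [← Finset.sum_product', ← Finset.sum_filter, Finset.sum_sigma']
  have hlast {ij : (Fin (n + 2) → Fin (d + 1)) × (Fin (n + 1) → Fin d)}
      (h : ij ∈ cutsTo d (n + 1) e) :
      (snoc (Fin.init (α := fun _ => Fin (d + 1)) ij.1) e,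
        snoc (Fin.init (α := fun _ => Fin d) ij.2) (ij.2 (Fin.last n))) = ij := by
    have h1 : ij.1 (Fin.last (n + 1)) = e := Fin.ext (mem_cutsTo.1 h).1
    rw [snoc, snoc, ← h1, Fin.snoc_init_self, Fin.snoc_init_self]
  refine Finset.sum_nbij'
    (fun ij => ⟨(Fin.init (α := fun _ => Fin (d + 1)) ij.1 (Fin.last n), ij.2 (Fin.last n)),
      (Fin.init (α := fun _ => Fin (d + 1)) ij.1, Fin.init (α := fun _ => Fin d) ij.2)⟩)
    (fun x => (snoc x.2.1 e, snoc x.2.2 x.1.2)) ?_ ?_ ?_ ?_ ?_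
  · intro ij h
    rw [← hlast h] at h
    have := snoc_mem_cutsTo.1 ⟨h, rfl⟩
    simp only [Finset.mem_sigma, Finset.mem_filter, Finset.mem_product, Finset.mem_univ, true_and]
    exact this
  · rintro ⟨⟨m, q⟩, i, j⟩ h
    simp only [Finset.mem_sigma, Finset.mem_filter, Finset.mem_product, Finset.mem_univ,
      true_and] at h
    exact (snoc_mem_cutsTo.2 h).1
  · intro ij h
    exact hlast h
  · rintro ⟨⟨m, q⟩, i, j⟩ h
    simp only [Finset.mem_sigma, Finset.mem_filter, Finset.mem_product, Finset.mem_univ,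
      true_and] at h
    have hm : i (Fin.last n) = m := (snoc_mem_cutsTo.2 h).2
    simp only [snoc, Fin.init_snoc, Fin.snoc_last, hm]
  · intro ij h
    rw [hlast h]

theorem block_snoc_castSucc (i : Fin (n + 1) → Fin (d + 1)) (j : Fin n → Fin d) (e : Fin (d + 1))
    (q : Fin d) (s : Fin n) : block (snoc i e) (snoc j q) s.castSucc = block i j s := by
  simp only [block, snoc, Fin.snoc_castSucc, ← Fin.castSucc_succ]

theorem block_snoc_last (i : Fin (n + 1) → Fin (d + 1)) (j : Fin n → Fin d) (e : Fin (d + 1))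
    (q : Fin d) : block (snoc i e) (snoc j q) (Fin.last n) = blockPos (i (Fin.last n)) q e := by
  simp only [block, blockPos, snoc, Fin.snoc_castSucc, Fin.succ_last, Fin.snoc_last]

theorem mem_block {i : Fin (n + 1) → Fin (d + 1)} {j : Fin n → Fin d} {s : Fin n} {p : Fin d} :
    p ∈ block i j s ↔ (i s.castSucc : ℕ) ≤ p ∧ (p : ℕ) < i s.succ ∧ p ≠ j s := by
  simp [block]

theorem lt_of_mem_block {e : ℕ} {i : Fin (n + 1) → Fin (d + 1)} {j : Fin n → Fin d}
    (h : (i, j) ∈ cutsTo d n e) {s : Fin n} {p : Fin d} (hp : p ∈ block i j s) : (p : ℕ) < e :=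
  (mem_block.1 hp).2.1.trans_le (cut_succ_le h s)

theorem mem_shifts {k : Fin d → ℕ} {i : Fin (n + 1) → Fin (d + 1)} {j : Fin n → Fin d}
    {l : Fin d → ℕ} : l ∈ shifts k i j ↔ (∀ p, l p ≤ ∑ p, k p) ∧
      (∀ p, (∀ s, p ∉ block i j s) → l p = 0) ∧
      ∀ s, block i j s = ∅ ∨ ∑ p ∈ block i j s, l p < k (j s) := by
  simp [shifts, Pi.le_def]

theorem mem_blockShifts {k : Fin d → ℕ} {β : Finset (Fin d)} {q : Fin d} {l : Fin d → ℕ} :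
    l ∈ blockShifts k β q ↔ (∀ p, l p ≤ ∑ p, k p) ∧ (∀ p, p ∉ β → l p = 0) ∧
      (β = ∅ ∨ ∑ p ∈ β, l p < k q) := by
  simp [blockShifts, Pi.le_def]

theorem eq_zero_of_mem_shifts {k : Fin d → ℕ} {e : ℕ} {i : Fin (n + 1) → Fin (d + 1)}
    {j : Fin n → Fin d} (h : (i, j) ∈ cutsTo d n e) {l : Fin d → ℕ} (hl : l ∈ shifts k i j)
    {p : Fin d} (hp : e ≤ p) : l p = 0 :=
  (mem_shifts.1 hl).2.1 p fun _ hs => absurd (lt_of_mem_block h hs) (not_lt.2 hp)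

theorem eq_zero_of_mem_blockShifts {k : Fin d → ℕ} {m e : ℕ} {q : Fin d} {l : Fin d → ℕ}
    (hl : l ∈ blockShifts k (blockPos m q e) q) {p : Fin d} (hp : (p : ℕ) < m) : l p = 0 :=
  (mem_blockShifts.1 hl).2.1 p fun hs => absurd (mem_blockPos.1 hs).1 (not_le.2 hp)

theorem sum_block_add {k : Fin d → ℕ} {m e : ℕ} {q : Fin d} {i : Fin (n + 1) → Fin (d + 1)}
    {j : Fin n → Fin d} (h : (i, j) ∈ cutsTo d n m) {l' : Fin d → ℕ} (l : Fin d → ℕ)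
    (hl' : l' ∈ blockShifts k (blockPos m q e) q) (s : Fin n) :
    ∑ p ∈ block i j s, (l + l') p = ∑ p ∈ block i j s, l p :=
  Finset.sum_congr rfl fun p hp => by
    rw [Pi.add_apply, eq_zero_of_mem_blockShifts hl' (lt_of_mem_block h hp), add_zero]

theorem sum_blockPos_add {k : Fin d → ℕ} {m e : ℕ} {q : Fin d} {i : Fin (n + 1) → Fin (d + 1)}
    {j : Fin n → Fin d} (h : (i, j) ∈ cutsTo d n m) {l : Fin d → ℕ} (l' : Fin d → ℕ)
    (hl : l ∈ shifts k i j) : ∑ p ∈ blockPos m q e, (l + l') p = ∑ p ∈ blockPos m q e, l' p :=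
  Finset.sum_congr rfl fun p hp => by
    rw [Pi.add_apply, eq_zero_of_mem_shifts h hl (mem_blockPos.1 hp).1, zero_add]

/-- The shifts for a sequence of cuts, in terms of those for all cuts but the last one. -/
theorem sum_shifts_snoc {M : Type*} [AddCommMonoid M] (k : Fin d → ℕ)
    {m e : Fin (d + 1)} {q : Fin d}
    {i : Fin (n + 1) → Fin (d + 1)} {j : Fin n → Fin d} (h : (i, j) ∈ cutsTo d n m)
    (f : (Fin d → ℕ) → M) :
    ∑ l ∈ shifts k (snoc i e) (snoc j q), f l =
      ∑ l ∈ shifts k i j, ∑ l' ∈ blockShifts k (blockPos m q e) q, f (l + l') := by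
  have hm : i (Fin.last n) = m := Fin.ext (mem_cutsTo.1 h).1
  have hmem (l : Fin d → ℕ) : l ∈ shifts k (snoc i e) (snoc j q) ↔
      (∀ p, l p ≤ ∑ p, k p) ∧
      (∀ p, (∀ s, p ∉ block i j s) → p ∉ blockPos m q e → l p = 0) ∧
      (∀ s, block i j s = ∅ ∨ ∑ p ∈ block i j s, l p < k (j s)) ∧
      (blockPos m q e = ∅ ∨ ∑ p ∈ blockPos m q e, l p < k q) := by
    simp only [mem_shifts, Fin.forall_fin_succ', block_snoc_castSucc, block_snoc_last, hm,
      Fin.snoc_castSucc, Fin.snoc_last, and_imp]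
  rw [← Finset.sum_product']
  have hlow (l : Fin d → ℕ) (s : Fin n) : ∑ p ∈ block i j s, (if (p : ℕ) < m then l p else 0) =
      ∑ p ∈ block i j s, l p :=
    Finset.sum_congr rfl fun p hp => if_pos (lt_of_mem_block h hp)
  have hhigh (l : Fin d → ℕ) : ∑ p ∈ blockPos m q e, (if (p : ℕ) < m then 0 else l p) =
      ∑ p ∈ blockPos m q e, l p :=
    Finset.sum_congr rfl fun p hp => if_neg (not_lt.2 (mem_blockPos.1 hp).1)
  have hsplit (l : Fin d → ℕ) : ((fun p : Fin d => if (p : ℕ) < m then l p else 0) +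
      fun p : Fin d => if (p : ℕ) < m then 0 else l p) = l := by
    funext p
    simp only [Pi.add_apply]
    split_ifs <;> simp
  refine Finset.sum_nbij' (fun l => (fun p => if (p : ℕ) < m then l p else 0,
    fun p => if (p : ℕ) < m then 0 else l p)) (fun l => l.1 + l.2) ?_ ?_ ?_ ?_ ?_
  · intro l hl
    obtain ⟨h1, h2, h3, h4⟩ := (hmem l).1 hl
    simp only [Finset.mem_product, mem_shifts, mem_blockShifts, hlow, hhigh]
    refine ⟨⟨fun p => ?_, fun p hp => ?_, h3⟩, fun p => ?_, fun p hp => ?_, h4⟩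
    · split_ifs
      exacts [h1 p, Nat.zero_le _]
    · split_ifs with hpm
      exacts [h2 p hp fun hp' => absurd hpm (not_lt.2 (mem_blockPos.1 hp').1), rfl]
    · split_ifs
      exacts [Nat.zero_le _, h1 p]
    · split_ifs with hpm
      exacts [rfl, h2 p (fun s hs => hpm (lt_of_mem_block h hs)) hp]
  · rintro ⟨l, l'⟩ hl
    obtain ⟨hl, hl'⟩ := Finset.mem_product.1 hl
    simp only at hl hl' ⊢
    rw [hmem, sum_blockPos_add h l' hl]
    simp only [sum_block_add h l hl']
    obtain ⟨h1, h2, h3⟩ := mem_shifts.1 hl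
    obtain ⟨h1', h2', h3'⟩ := mem_blockShifts.1 hl'
    refine ⟨fun p => ?_, fun p hp hp' => ?_, h3, h3'⟩
    · rcases lt_or_ge (p : ℕ) m with hp | hp
      · rw [Pi.add_apply, eq_zero_of_mem_blockShifts hl' hp]
        exact h1 p
      · rw [Pi.add_apply, eq_zero_of_mem_shifts h hl hp, zero_add]
        exact h1' p
    · rw [Pi.add_apply, h2 p hp, h2' p hp']
  · intro l _
    exact hsplit l
  · rintro ⟨l, l'⟩ hl
    obtain ⟨hl, hl'⟩ := Finset.mem_product.1 hl
    simp only at hl hl'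
    refine Prod.ext (funext fun p => ?_) (funext fun p => ?_) <;> simp only [Pi.add_apply] <;>
      split_ifs with hp
    · rw [eq_zero_of_mem_blockShifts hl' hp, add_zero]
    · rw [eq_zero_of_mem_shifts h hl (not_lt.1 hp)]
    · rw [eq_zero_of_mem_blockShifts hl' hp]
    · rw [eq_zero_of_mem_shifts h hl (not_lt.1 hp), zero_add]
  · intro l _
    exact congrArg f (hsplit l).symm

theorem weight_add {k : Fin d → ℕ} {m e : ℕ} {q : Fin d} {i : Fin (n + 1) → Fin (d + 1)}
    {j : Fin n → Fin d} (h : (i, j) ∈ cutsTo d n m) {l l' : Fin d → ℕ} (hl : l ∈ shifts k i j)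
    (hl' : l' ∈ blockShifts k (blockPos m q e) q) :
    weight k (l + l') = weight k l * weight k l' := by
  rw [weight, weight, weight, ← Finset.prod_mul_distrib]
  refine Finset.prod_congr rfl fun p _ => ?_
  rw [Pi.add_apply]
  rcases lt_or_ge (p : ℕ) m with hp | hp
  · rw [eq_zero_of_mem_blockShifts hl' hp, add_zero, add_zero, coef_self, mul_one]
  · rw [eq_zero_of_mem_shifts h hl hp, zero_add, add_zero, coef_self, one_mul]

theorem leftFactor_snoc {k : Fin d → ℕ} {m e : Fin (d + 1)} {q : Fin d} (hmq : (m : ℕ) ≤ q)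
    {i : Fin (n + 1) → Fin (d + 1)}
    {j : Fin n → Fin d} (h : (i, j) ∈ cutsTo d n m) {l l' : Fin d → ℕ} (hl : l ∈ shifts k i j)
    (hl' : l' ∈ blockShifts k (blockPos m q e) q) :
    leftFactor k (snoc i e) (snoc j q) (l + l') =
      shuffle (shuffle (leftFactor k i j l) (antipode (subword (k + l') m q)))
        (subword (k + l') (q + 1) e) := by
  have hm : i (Fin.last n) = m := Fin.ext (mem_cutsTo.1 h).1
  have h1 (a b : ℕ) (hb : b ≤ m) : subword (k + (l + l')) a b = subword (k + l) a b :=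
    subword_congr fun p _ hp => by
      simp only [Pi.add_apply]
      rw [eq_zero_of_mem_blockShifts hl' (by omega), add_zero]
  have h2 (a b : ℕ) (ha : m ≤ a) : subword (k + (l + l')) a b = subword (k + l') a b :=
    subword_congr fun p hp _ => by
      simp only [Pi.add_apply]
      rw [eq_zero_of_mem_shifts h hl (by omega), zero_add]
  have h0 : snoc i e 0 = i 0 := Fin.snoc_castSucc (α := fun _ => Fin (d + 1)) _ _ 0
  rw [leftFactor, leftFactor, List.finRange_succ_last, List.foldl_append, List.foldl_map, h0]
  simp only [List.foldl_cons, List.foldl_nil, Fin.snoc_castSucc, Fin.snoc_last, Fin.succ_last, hm,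
    ← Fin.castSucc_succ]
  rw [h2 _ _ le_rfl, h2 _ _ (by omega)]
  congr 4
  refine List.foldl_ext _ _ _ fun X s _ => ?_
  have hs := cut_succ_le h s
  have hs' := ((mem_cutsTo.1 h).2 s).2
  rw [h1 _ _ (by omega), h1 _ _ hs]

theorem rightFactor_snoc {k : Fin d → ℕ} {m e : Fin (d + 1)} {q : Fin d}
    {i : Fin (n + 1) → Fin (d + 1)}
    {j : Fin n → Fin d} (h : (i, j) ∈ cutsTo d n m) {l l' : Fin d → ℕ} (hl : l ∈ shifts k i j)
    (hl' : l' ∈ blockShifts k (blockPos m q e) q) :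
    rightFactor k (snoc i e) (snoc j q) (l + l') =
      rightFactor k i j l * v (k q - ∑ p ∈ blockPos m q e, l' p) := by
  have hm : i (Fin.last n) = m := Fin.ext (mem_cutsTo.1 h).1
  rw [rightFactor, List.ofFn_succ', List.concat_eq_append, word_append, word_singleton]
  simp only [block_snoc_castSucc, block_snoc_last, Fin.snoc_castSucc, Fin.snoc_last, hm]
  rw [sum_blockPos_add h l' hl]
  simp only [sum_block_add h l hl']
  rfl

/-- Admissible shifts vanish at the distinguished positions `j s`. -/
theorem eq_zero_at_cut {k : Fin d → ℕ} {e : ℕ} {i : Fin (n + 1) → Fin (d + 1)}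
    {j : Fin n → Fin d} (h : (i, j) ∈ cutsTo d n e) {l : Fin d → ℕ} (hl : l ∈ shifts k i j)
    (s : Fin n) : l (j s) = 0 := by
  refine (mem_shifts.1 hl).2.1 _ fun s' hs' => ?_
  rw [mem_block] at hs'
  have hs := (mem_cutsTo.1 h).2 s
  have hmono := (strictMono_of_mem_cutsTo h).monotone
  rcases lt_trichotomy s s' with hlt | rfl | hlt
  · have : (i s.succ : ℕ) ≤ i s'.castSucc := hmono (Fin.succ_le_castSucc_iff.2 hlt)
    omega
  · exact hs'.2.2 rfl
  · have : (i s'.succ : ℕ) ≤ i s.castSucc := hmono (Fin.succ_le_castSucc_iff.2 hlt)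
    omega

theorem formulaMult_eq_weight {k : Fin d → ℕ} {e : ℕ} {i : Fin (n + 1) → Fin (d + 1)}
    {j : Fin n → Fin d} (h : (i, j) ∈ cutsTo d n e) {l : Fin d → ℕ} (hl : l ∈ shifts k i j) :
    formulaMult k j l = weight k l := by
  rw [formulaMult, mult_eq_prod, weight,
    ← Finset.prod_subtype (Finset.univ.filter fun p : Fin d => ∀ s, p ≠ j s) (by simp)
      (fun p => coef (k p + l p) (k p))]
  refine Finset.prod_subset (Finset.filter_subset _ _) fun p _ hp => ?_
  simp only [Finset.mem_filter, Finset.mem_univ, true_and, not_forall, not_not] at hp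
  obtain ⟨s, rfl⟩ := hp
  rw [eq_zero_at_cut h hl, add_zero, coef_self]

end cuts

/-! ### The dual of the Grossman–Larson product -/

/-- `A ↦ A ⊛ B`, as an element of the convolution algebra. -/
def glConv (B : QV) : WithConv (QV →ₗ[ℚ] QV) := toConv LinearMap.id * triangleHom B

theorem glConv_apply (A B : QV) : glConv B A = glProduct ariTriangle A B := rfl

theorem glConv_mul (B C : QV) : glConv (B * C) = glConv B * triangleHom C := by
  rw [glConv, glConv, map_mul, mul_assoc]

theorem glConv_add (B C : QV) : glConv (B + C) = glConv B + glConv C := by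
  rw [glConv, map_add, mul_add]
  rfl

theorem glConv_smul (r : ℚ) (B : QV) : glConv (r • B) = r • glConv B := by
  rw [glConv, map_smul, mul_smul_comm]
  rfl

theorem glConv_one : glConv 1 = toConv LinearMap.id := by
  rw [glConv, map_one, mul_one]

section

variable {d : ℕ}

/-- The functional `A ↦ (f A ∣ C)`. -/
def dualComp (C : QV) (f : WithConv (QV →ₗ[ℚ] QV)) : WithConv (QV →ₗ[ℚ] ℚ) :=
  toConv ((dual C).ofConv ∘ₗ f.ofConv)

theorem dualComp_apply (C A : QV) (f : WithConv (QV →ₗ[ℚ] QV)) :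
    dualComp C f A = pairing (f A) C := rfl

theorem dualComp_mul (k : Fin d → ℕ) {a b : ℕ} (hab : a ≤ b) (hb : b ≤ d)
    (f g : WithConv (QV →ₗ[ℚ] QV)) : dualComp (subword k a b) (f * g) =
      ∑ m ∈ Finset.Icc a b, dualComp (subword k a m) f * dualComp (subword k m b) g := by
  ext A
  have h (s : Finset ℕ) (F : ℕ → WithConv (QV →ₗ[ℚ] ℚ)) : (∑ m ∈ s, F m) A = ∑ m ∈ s, F m A := by
    change (∑ m ∈ s, F m).ofConv A = _
    rw [WithConv.ofConv_sum, LinearMap.sum_apply]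
  rw [dualComp_apply, h]
  simp only [LinearMap.convMul_apply]
  generalize (Coalgebra.comul A : QV ⊗[ℚ] QV) = X
  induction X with
  | zero => simp
  | add X Y hX hY =>
    simp only [map_add, LinearMap.add_apply, hX, hY, Finset.sum_add_distrib]
  | tmul x y =>
    simp only [TensorProduct.map_tmul, LinearMap.mul'_apply]
    exact pairing_mul_subword k _ _ hb hab

theorem dualComp_triangleHom_v (k : Fin d → ℕ) (s : ℕ) {a b : ℕ} (hab : a ≤ b) (hb : b ≤ d) :
    dualComp (subword k a b) (triangleHom (v s)) =
      ∑ q : Fin d, if a ≤ q ∧ (q : ℕ) < b then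
        ∑ l ∈ blockShifts k (blockPos a q b) q,
          (weight k l * if s = k q - ∑ p ∈ blockPos a q b, l p then 1 else 0) • sides k l a q b
      else 0 := by
  ext A
  rw [dualComp_apply]
  change pairing ((triangleHom (v s)).ofConv A) _ = _
  rw [triangleHom_v, letterTriangle_apply, pairing_act_subword k s hab hb]
  rw [WithConv.ofConv_sum, LinearMap.sum_apply]
  refine Finset.sum_congr rfl fun q _ => ?_
  split_ifs
  · rw [WithConv.ofConv_sum, LinearMap.sum_apply]
    rfl
  · rfl

/-- The functional dual to the Grossman–Larson product with a word of length `n`. -/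
theorem dualComp_glConv_word (k : Fin d → ℕ) (n : ℕ) (w : List ℕ) (hw : w.length = n)
    (e : Fin (d + 1)) : dualComp (subword k 0 e) (glConv (word w)) =
      ∑ ij ∈ cutsTo d n e, ∑ l ∈ shifts k ij.1 ij.2,
        (weight k l * pairing (word w) (rightFactor k ij.1 ij.2 l)) •
          dual (leftFactor k ij.1 ij.2 l) := by
  induction n generalizing w e with
  | zero =>
    obtain rfl := List.length_eq_zero_iff.1 hw
    rw [Finset.sum_eq_single (fun _ => e, Fin.elim0)]
    · rw [Finset.sum_eq_single 0]
      · rw [word_nil, glConv_one]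
        simp only [leftFactor, rightFactor, List.finRange_zero, List.foldl_nil, List.ofFn_zero,
          word_nil, pairing_one_one, weight, Pi.zero_apply, add_zero, coef_self,
          Finset.prod_const_one,
          mul_one, one_smul]
        rfl
      · intro l hl hne
        exact absurd (funext fun p => (mem_shifts.1 hl).2.1 p fun s => s.elim0) hne
      · intro hn
        exact absurd (mem_shifts.2 ⟨fun _ => Nat.zero_le _, fun _ _ => rfl, fun s => s.elim0⟩) hn
    · rintro ⟨i, j⟩ hij hne
      refine absurd (Prod.ext (funext fun x => ?_) (Subsingleton.elim _ _)) hne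
      rw [Subsingleton.elim (α := Fin 1) x (Fin.last 0)]
      exact Fin.ext (mem_cutsTo.1 hij).1
    · intro hn
      exact absurd (mem_cutsTo.2 ⟨rfl, fun s => s.elim0⟩) hn
  | succ n ih =>
    obtain rfl | ⟨w, s, rfl⟩ := List.eq_nil_or_concat w
    · simp at hw
    have hw' : w.length = n := by simpa using hw
    have he : (e : ℕ) ≤ d := Nat.le_of_lt_succ e.2
    rw [List.concat_eq_append, word_append, word_singleton, glConv_mul,
      dualComp_mul k (Nat.zero_le _) he, sum_cutsTo_succ]
    let E : ℕ → WithConv (QV →ₗ[ℚ] ℚ) := fun m =>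
      dualComp (subword k 0 m) (glConv (word w)) *
        ∑ q : Fin d, if m ≤ q ∧ (q : ℕ) < e then
        ∑ l ∈ blockShifts k (blockPos m q e) q,
          (weight k l * if s = k q - ∑ p ∈ blockPos m q e, l p then 1 else 0) • sides k l m q e
      else 0
    -- Cuts `m > e` leave no position for the last block, so the range of `m` can be enlarged.
    trans ∑ m ∈ Finset.range (d + 1), E m
    · refine (Finset.sum_congr rfl fun m hm => ?_).trans (Finset.sum_subset ?_ ?_)
      · rw [dualComp_triangleHom_v k s (Finset.mem_Icc.1 hm).2 he]
      · intro m hm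
        rw [Finset.mem_Icc] at hm
        rw [Finset.mem_range]
        omega
      · intro m _ hm
        have hm' : (e : ℕ) < m := by
          by_contra h
          exact hm (Finset.mem_Icc.2 ⟨Nat.zero_le _, not_lt.1 h⟩)
        simp only [E]
        rw [Finset.sum_eq_zero fun q _ => if_neg (by omega), mul_zero]
    rw [Finset.sum_range]
    refine Finset.sum_congr rfl fun m _ => ?_
    simp only [E]
    rw [Finset.mul_sum]
    refine Finset.sum_congr rfl fun q _ => ?_
    split_ifs with hq
    swap
    · rw [mul_zero]
    rw [ih w hw' m, Finset.sum_mul]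
    refine Finset.sum_congr rfl fun ij hij => ?_
    rw [Finset.sum_mul_sum, sum_shifts_snoc k hij]
    refine Finset.sum_congr rfl fun l hl => Finset.sum_congr rfl fun l' hl' => ?_
    rw [leftFactor_snoc hq.1 hij hl hl', rightFactor_snoc hij hl hl', pairing_mul_v,
      weight_add hij hl hl', dual_shuffle, dual_shuffle, smul_mul_smul_comm, sides,
      ← mul_assoc (dual _)]
    congr 1
    split_ifs <;> ring

end

theorem tmul_pairing_word_coproductFormula {d : ℕ} (k : Fin d → ℕ) (A : QV) (w : List ℕ) :
    (pairing.tmul pairing) (A ⊗ₜ[ℚ] word w) (coproductFormula k) =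
      pairing (glProduct ariTriangle A (word w)) (word (List.ofFn k)) := by
  have hlen (n : ℕ) (i : Fin (n + 1) → Fin (d + 1)) (j : Fin n → Fin d) (l : Fin d → ℕ)
      (hn : n ≠ w.length) : pairing (word w) (rightFactor k i j l) = 0 := by
    rw [rightFactor, pairing_word, if_neg]
    rintro rfl
    simp at hn
  have h := congrArg (fun f : WithConv (QV →ₗ[ℚ] ℚ) => f A)
    (dualComp_glConv_word k w.length w rfl (Fin.last d))
  simp only [Fin.val_last, subword_full, dualComp_apply, glConv_apply] at h
  rw [h, coproductFormula, map_sum]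
  have hterm (n : ℕ) : (pairing.tmul pairing) (A ⊗ₜ[ℚ] word w)
      (∑ ij ∈ cuts d n, ∑ l ∈ shifts k ij.1 ij.2,
        formulaMult k ij.2 l • (leftFactor k ij.1 ij.2 l ⊗ₜ[ℚ] rightFactor k ij.1 ij.2 l)) =
      (∑ ij ∈ cutsTo d n d, ∑ l ∈ shifts k ij.1 ij.2,
        (weight k l * pairing (word w) (rightFactor k ij.1 ij.2 l)) •
          dual (leftFactor k ij.1 ij.2 l)) A := by
    change _ = (∑ ij ∈ cutsTo d n d, _ : WithConv (QV →ₗ[ℚ] ℚ)).ofConv A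
    rw [WithConv.ofConv_sum, LinearMap.sum_apply, map_sum]
    refine Finset.sum_congr rfl fun ij hij => ?_
    rw [WithConv.ofConv_sum, LinearMap.sum_apply, map_sum]
    refine Finset.sum_congr rfl fun l hl => ?_
    rw [map_smul, tmul_pairing, formulaMult_eq_weight hij hl, smul_eq_mul,
      mul_comm (pairing A _), ← mul_assoc]
    rfl
  simp only [hterm]
  by_cases hw : w.length < d + 1
  · refine Finset.sum_eq_single_of_mem _ (Finset.mem_range.2 hw) fun n _ hn => ?_
    simp only [hlen n _ _ _ hn, mul_zero, zero_smul, Finset.sum_const_zero]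
    rfl
  · rw [cutsTo_eq_empty (by omega), Finset.sum_empty]
    refine Finset.sum_eq_zero fun n hn => ?_
    rw [Finset.mem_range] at hn
    simp only [hlen n _ _ _ (by omega), mul_zero, zero_smul, Finset.sum_const_zero]
    rfl

/-- The explicit formula is dual to the Grossman–Larson product. -/
theorem tmul_pairing_coproductFormula {d : ℕ} (k : Fin d → ℕ) (A B : QV) :
    (pairing.tmul pairing) (A ⊗ₜ[ℚ] B) (coproductFormula k) =
      pairing (glProduct ariTriangle A B) (word (List.ofFn k)) := by
  have hB : B ∈ Submodule.span ℚ (Set.range word) := span_word ▸ Submodule.mem_top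
  simp only [← glConv_apply]
  induction hB using Submodule.span_induction with
  | mem _ h => obtain ⟨w, rfl⟩ := h; exact tmul_pairing_word_coproductFormula k A w
  | zero => simp [glConv]
  | add B C _ _ hB hC =>
    rw [TensorProduct.tmul_add, map_add, LinearMap.add_apply, hB, hC, glConv_add,
      ← LinearMap.add_apply, ← map_add]
    rfl
  | smul r B _ hB =>
    rw [TensorProduct.tmul_smul, map_smul, LinearMap.smul_apply, hB, glConv_smul,
      ← LinearMap.smul_apply, ← map_smul]
    rfl

/-- The coproduct given on words by the explicit formula. -/
def coproduct : QV →ₗ[ℚ] QV ⊗[ℚ] QV :=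
  wordBasis.constr ℚ fun w => coproductFormula w.toList.get

theorem isDualCoproduct_coproduct : IsDualCoproduct ariTriangle coproduct := by
  intro A B C
  have h : pairing (glProduct ariTriangle A B) =
      (pairing.tmul pairing) (A ⊗ₜ[ℚ] B) ∘ₗ coproduct := linearMap_ext_word fun w => by
    rw [LinearMap.comp_apply, ← wordBasis_ofList, coproduct, Module.Basis.constr_basis,
      tmul_pairing_coproductFormula, List.ofFn_get, wordBasis_ofList]
    rfl
  exact LinearMap.congr_fun h C

theorem IsDualCoproduct.unique {T : QV →ₗ[ℚ] QV →ₗ[ℚ] QV} {Δ Δ' : QV →ₗ[ℚ] QV ⊗[ℚ] QV}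
    (h : IsDualCoproduct T Δ) (h' : IsDualCoproduct T Δ') : Δ = Δ' :=
  LinearMap.ext fun C => eq_of_tmul_pairing_eq fun A B => by rw [← h, ← h']

/-- The value on words of a coproduct dual to the Grossman–Larson product. -/
theorem IsDualCoproduct.apply_word {Δ : QV →ₗ[ℚ] QV ⊗[ℚ] QV} (h : IsDualCoproduct ariTriangle Δ)
    {d : ℕ} (k : Fin d → ℕ) : Δ (word (List.ofFn k)) = coproductFormula k :=
  eq_of_tmul_pairing_eq fun A B => by rw [← h, tmul_pairing_coproductFormula]

end Ari

end

theorem theorem5p16 :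
    (∃! T : Ari.QV →ₗ[ℚ] Ari.QV →ₗ[ℚ] Ari.QV, Ari.IsAriTriangle T) ∧
      ∀ T : Ari.QV →ₗ[ℚ] Ari.QV →ₗ[ℚ] Ari.QV, Ari.IsAriTriangle T →
        (∃! Δ : Ari.QV →ₗ[ℚ] Ari.QV ⊗[ℚ] Ari.QV, Ari.IsDualCoproduct T Δ) ∧
          ∀ Δ : Ari.QV →ₗ[ℚ] Ari.QV ⊗[ℚ] Ari.QV, Ari.IsDualCoproduct T Δ →
            ∀ (d : ℕ) (k : Fin d → ℕ),
              Δ (Ari.word (List.ofFn k)) = Ari.coproductFormula k := by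
  refine ⟨⟨_, Ari.isAriTriangle_ariTriangle, fun _ hT => hT.eq_ariTriangle⟩, fun T hT => ?_⟩
  obtain rfl := hT.eq_ariTriangle
  exact ⟨⟨_, Ari.isDualCoproduct_coproduct, fun _ h => h.unique Ari.isDualCoproduct_coproduct⟩,
    fun _ h _ => h.apply_word⟩
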